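/- Setting. Let $\Omega$ be a finite set, let $\Delta(\Omega)$ be the set of probability distributions (beliefs) on $\Omega$ with the total variation distance, and let $F_0$ be the set of finitely supported probability distributions on $\Delta(\Omega)$ (experiments). For $e=(\lambda_j,p_j)_{j\in[m]}\in F_0$ with distinct $p_j$, $\lambda_j>0$ and $\sum_j\lambda_j=1$, write $e(p_j)=\lambda_j$, $\tau(e)=\{p_1,\dots,p_m\}$ and $\sigma(e)=\sum_j\lambda_jp_j$. The trivial experiments are the Dirac distributions $\delta_p$, $p\in\Delta(\Omega)$; let $T$ be the set of them. Fix a set $F$ of feasible experiments with $T\subseteq F\subseteq F_0$, a prior $\mu\in\Delta(\Omega)$ and an upper semicontinuous $v:\Delta(\Omega)\to[\underline V,\overline V]$ with $0<\underline V\le\overline V<\infty$. An $n$-step sequential persuasion from $\mu$ is a sequence $(\Xi_0,\phi_1,\Xi_1,\dots,\phi_n,\Xi_n)$ with $\Xi_0=\{(\mu)\}$ such that each $\phi_i$ assigns to every history $\xi=(p_0,e_1,p_1,\dots,e_{i-1},p_{i-1})\in\Xi_{i-1}$ an experiment $\phi_i(\xi)\in F$ with $\sigma(\phi_i(\xi))=\mathrm{last}(\xi):=p_{i-1}$,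 and $\Xi_i$ is the set of the extensions of histories $\xi\in\Xi_{i-1}$ by $(\phi_i(\xi),p)$, $p\in\tau(\phi_i(\xi))$. An infinite sequential persuasion is an infinite sequence of this kind. Put $\Pr[(p_0,e_1,p_1,\dots,e_i,p_i)]=\prod_{j=1}^{i} e_j(p_j)$. The persuasion terminates after $\xi\in\Xi_i$ if from $\xi$ on it always chooses the trivial experiment $\delta_{\mathrm{last}(\xi)}$ (in all remaining steps); $\Pr[S\text{ terminates after }n\text{ steps}]$ is the total probability of those $\xi\in\Xi_n$ after which $S$ terminates. The expected utility of an $n$-step persuasion is $\mathcal V(S^{(n)})=\sum_{\xi\in\Xi_n}\Pr[\xi]\,v(\mathrm{last}(\xi))$, that of an infinite one is $$\mathcal V(S)=\sup_{n\in\mathbb N}\ \sum_{\xi\in\Xi_n,\ S\text{ terminates after }\xi}\Pr[\xi]\,v(\mathrm{last}(\xi)),$$ and $v_\infty(\mu)$ is the supremum of $\mathcal V(S)$ over all infinite sequential persuasions $S$ from $\mu$. Such an $S$ is optimal if $\mathcal V(S)=v_\infty(\mu)$. It is Markov if there are disjoint sets $D,Z\subseteq\Delta(\Omega)$ with $\mu\in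 D\cup Z$ and a map $\rho:D\to F\setminus T$ with $\sigma(\rho(p))=p$ and $\tau(\rho(p))\subseteq D\cup Z$ for all $p\in D$, such that for all $i\ge 0$ and $\xi\in\Xi_i$: $\phi_{i+1}(\xi)=\rho(\mathrm{last}(\xi))$ if $\mathrm{last}(\xi)\in D$, and $\phi_{i+1}(\xi)=\delta_{\mathrm{last}(\xi)}$ if $\mathrm{last}(\xi)\in Z$. Assumption 1. There is $h\in\mathbb N$ with $|\tau(e)|\le h$ for all $e\in F$, and whenever a sequence in $F$ converges weakly to a Borel probability measure $e$ on $\Delta(\Omega)$, then $e\in F$. Assumption 3 (for $\mu$). There is a sequence $(S_k)_{k\ge1}$, where $S_k$ is an $n_k$-step sequential persuasion from $\mu$, such that $\lim_{k\to\infty}\mathcal V(S_k)=v_\infty(\mu)$, and for every $\epsilon>0$ there is $n_\epsilon\in\mathbb N$ such that $\Pr[S_k\text{ terminates after }n_\epsilon\text{ steps}]\ge1-\epsilon$ for every $k$ with $n_k\ge n_\epsilon$. Theorem. (a) Under Assumption 1, an optimal infinite sequential persuasion from $\mu$ exists if and only if Assumption 3 holds. (b) If an optimal infinite sequential persuasion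 from $\mu$ exists, then there is an optimal infinite sequential persuasion from $\mu$ that is Markov. -/

import Mathlib

open MeasureTheory Filter Topology

noncomputable section

namespace SeqPersuasion

/-- Beliefs: probability distributions on the finite set `Ω` of world states. The topology is that of
`Ω → ℝ`, which on this set is the topology of the total variation distance. -/
abbrev Belief (Ω : Type*) [Fintype Ω] : Type _ := stdSimplex ℝ Ω

/-- Experiments: finitely supported probability distributions over beliefs. -/
abbrev Experiment (Ω : Type*) [Fintype Ω] : Type _ := Convexity.StdSimplex ℝ (Belief Ω)

section Basic

variable {Ω : Type*} [Fintype Ω]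

namespace Experiment

/-- The set of beliefs to which the experiment gives positive probability. -/
def supp (e : Experiment Ω) : Finset (Belief Ω) := e.weights.support

/-- The expectation of the experiment, again a belief. -/
def mean (e : Experiment Ω) : Belief Ω :=
  ⟨∑ p ∈ e.supp, e.weights p • (p : Ω → ℝ),
    (convex_stdSimplex ℝ Ω).sum_mem (fun p _ => e.nonneg p) e.total (fun p _ => p.2)⟩

/-- The trivial experiment at `p`: the belief stays `p` with probability one. -/
def triv (p : Belief Ω) : Experiment Ω := Convexity.StdSimplex.single p

/-- The experiment as a Borel probability measure on the space of beliefs. -/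
def toProb (e : Experiment Ω) : ProbabilityMeasure (Belief Ω) :=
  ⟨∑ p ∈ e.supp, ENNReal.ofReal (e.weights p) • Measure.dirac p, ⟨by
    have h : ∑ p ∈ e.supp, e.weights p = 1 := e.total
    simp [← ENNReal.ofReal_sum_of_nonneg (fun p _ => e.nonneg p), h]⟩⟩

end Experiment

/-- The set of all trivial experiments. -/
def trivialExperiments (Ω : Type*) [Fintype Ω] : Set (Experiment Ω) := Set.range Experiment.triv

/-- Uniformly bounded support sizes, and closedness under weak limits of sequences, where the limit is
an arbitrary Borel probability measure on the space of beliefs. -/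
def ClosedFeasible (F : Set (Experiment Ω)) : Prop :=
  (∃ h : ℕ, ∀ e ∈ F, e.supp.card ≤ h) ∧
    ∀ (e : ℕ → Experiment Ω) (Q : ProbabilityMeasure (Belief Ω)), (∀ i, e i ∈ F) →
      Tendsto (fun i => (e i).toProb) atTop (𝓝 Q) → ∃ e' ∈ F, e'.toProb = Q

/-- Alternating sequences `(p₀, e₁, p₁, …, eₙ, pₙ)` of beliefs and experiments. -/
inductive History (Ω : Type*) [Fintype Ω] : ℕ → Type _
  | start (p : Belief Ω) : History Ω 0
  | step {n : ℕ} (ξ : History Ω n) (e : Experiment Ω) (p : Belief Ω) : History Ω (n + 1)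

namespace History

/-- The current belief at the end of a history. -/
def last : {n : ℕ} → History Ω n → Belief Ω
  | _, start p => p
  | _, step _ _ p => p

/-- The probability of a history: the product of the probabilities of its outcomes. -/
def prob : {n : ℕ} → History Ω n → ℝ
  | _, start _ => 1
  | _, step ξ e p => ξ.prob * e.weights p

/-- The history followed by `l` trivial experiments. -/
def stay {n : ℕ} (ξ : History Ω n) : (l : ℕ) → History Ω (n + l)
  | 0 => ξ
  | l + 1 => (ξ.stay l).step (Experiment.triv ξ.last) ξ.last

end History

/-- A rule which after each history `ξ` of length `i` names the next experiment `φ i ξ`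
(the experiment of step number `i + 1`). Only its values on the histories that it
generates itself, up to the horizon, ever matter. -/
abbrev Rule (Ω : Type*) [Fintype Ω] : Type _ := (i : ℕ) → History Ω i → Experiment Ω

namespace Rule

open Classical in
/-- The set of `i`-step histories generated from `μ` by the rule. -/
def histories (φ : Rule Ω) (μ : Belief Ω) : (i : ℕ) → Finset (History Ω i)
  | 0 => {History.start μ}
  | i + 1 => (φ.histories μ i).biUnion fun ξ => (φ i ξ).supp.image fun p => ξ.step (φ i ξ) p

/-- The rule is a sequential persuasion from `μ` with feasible set `F` and horizon `N`:
an `n`-step one for `N = n`, an infinite one for `N = ⊤`. -/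
def IsPersuasion (φ : Rule Ω) (F : Set (Experiment Ω)) (μ : Belief Ω) (N : ℕ∞) : Prop :=
  ∀ i : ℕ, (i : ℕ∞) < N → ∀ ξ ∈ φ.histories μ i, φ i ξ ∈ F ∧ (φ i ξ).mean = ξ.last

/-- With horizon `N`, the rule chooses only the trivial experiment from `ξ` on. -/
def TerminatesAfter (φ : Rule Ω) (N : ℕ∞) {i : ℕ} (ξ : History Ω i) : Prop :=
  ∀ l : ℕ, ((i + l : ℕ) : ℕ∞) < N → φ (i + l) (ξ.stay l) = Experiment.triv ξ.last

open Classical in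
/-- The probability that the rule with horizon `N` terminates after `n` steps. -/
def probTerminates (φ : Rule Ω) (μ : Belief Ω) (N : ℕ∞) (n : ℕ) : ℝ :=
  ∑ ξ ∈ φ.histories μ n, if φ.TerminatesAfter N ξ then ξ.prob else 0

/-- Expected utility of an `n`-step sequential persuasion: the expectation of `v` at the belief
after `n` steps. -/
def finValue (φ : Rule Ω) (v : Belief Ω → ℝ) (μ : Belief Ω) (n : ℕ) : ℝ :=
  ∑ ξ ∈ φ.histories μ n, ξ.prob * v ξ.last

open Classical in
/-- Expected utility of an infinite sequential persuasion: utility is realized only after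
termination. -/
def infValue (φ : Rule Ω) (v : Belief Ω → ℝ) (μ : Belief Ω) : ℝ :=
  ⨆ n : ℕ, ∑ ξ ∈ φ.histories μ n, if φ.TerminatesAfter ⊤ ξ then ξ.prob * v ξ.last else 0

end Rule

/-- The supremum of the expected utilities of the infinite sequential persuasions from `μ`. -/
def vInf (F : Set (Experiment Ω)) (v : Belief Ω → ℝ) (μ : Belief Ω) : ℝ :=
  sSup {x | ∃ φ : Rule Ω, φ.IsPersuasion F μ ⊤ ∧ φ.infValue v μ = x}

/-- Optimal infinite sequential persuasions from `μ`. -/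
def IsOptimal (F : Set (Experiment Ω)) (v : Belief Ω → ℝ) (μ : Belief Ω) (φ : Rule Ω) : Prop :=
  φ.IsPersuasion F μ ⊤ ∧ φ.infValue v μ = vInf F v μ

/-- There is a sequence of finite persuasions from `μ` (the `k`-th one with `n k` steps) whose expected
utilities tend to the supremum and which have a common rate of termination. -/
def UniformTermination (F : Set (Experiment Ω)) (v : Belief Ω → ℝ) (μ : Belief Ω) : Prop :=
  ∃ (n : ℕ → ℕ) (S : ℕ → Rule Ω),
    (∀ k, (S k).IsPersuasion F μ (n k)) ∧
    Tendsto (fun k => (S k).finValue v μ (n k)) atTop (𝓝 (vInf F v μ)) ∧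
    ∀ ε : ℝ, 0 < ε → ∃ m : ℕ, ∀ k, m ≤ n k → 1 - ε ≤ (S k).probTerminates μ (n k) m

/-- `φ` is Markov: there are disjoint sets `D` of intermediate and `Z` of terminating beliefs and a map
`ρ` from `D` to nontrivial feasible experiments, such that `φ` applies `ρ` to the current belief as long
as that is in `D`, and the trivial experiment once it is in `Z`. -/
def IsMarkov (F : Set (Experiment Ω)) (μ : Belief Ω) (φ : Rule Ω) : Prop :=
  ∃ (D Z : Set (Belief Ω)) (ρ : D → Experiment Ω),
    Z ⊆ Dᶜ ∧ μ ∈ D ∪ Z ∧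
    (∀ p : D, ρ p ∈ F \ trivialExperiments Ω ∧ (ρ p).mean = p ∧ ((ρ p).supp : Set (Belief Ω)) ⊆ D ∪ Z) ∧
    ∀ i : ℕ, ∀ ξ ∈ φ.histories μ i,
      (∀ hp : ξ.last ∈ D, φ i ξ = ρ ⟨ξ.last, hp⟩) ∧
      (ξ.last ∈ Z → φ i ξ = Experiment.triv ξ.last)

end Basic

end SeqPersuasion

end

/-! Let `U = supVal` be the supremum of the utilities attainable in finitely many steps. Every
feasible experiment makes `U` a supermartingale, and `U` dominates `v`, so `vInf = U`
(`vInf_eq_supVal`). Along an optimal persuasion `U` must be a martingale and stopping can occur only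
where `v = U`. Since `v` is bounded away from zero, mass that never stops is a real loss, so the
persuasion stops almost surely. Conversely, these three properties imply optimality
(`Rule.le_infValue`).

For (a), truncating an optimal persuasion gives uniformly terminating ones. For the converse,
uniform termination yields a cost `c` of the stopping time that tends to infinity although the
expected costs of all the finite persuasions stay bounded. The closure of the attainable triples
(belief, utility, cost) has a recursive structure: by upper semicontinuity and compactness, a limit
triple is dominated by stopping or is split by a feasible experiment into limit triples of the next
period (`ReachLim.halt_or_step`). A finite cost bounds the mass that stops late, so no limit utility
exceeds `U` (`ReachLim.le_supVal`); hence a triple of utility `U` splits into triples of utility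
`U`. Following these splittings, with the cost as memory, keeps `U` a martingale, and Markov's
inequality for the cost gives almost sure stopping.

For (b), let `Z` be the set where `v = U`. Selecting one of the choices of the optimal rule at each
belief keeps `U` a martingale, but with infinitely many beliefs a careless selection may fail to
reach `Z`. The selection is therefore fixed on finitely many beliefs at a time. However it was fixed
on a finite `K`, extensions still reach `Z` with probability near one
(`certSup_eq_one_of_maximum_principle`): outside `K` the original rule provides a maximum principle,
and inside `K` a nontrivial experiment strictly increases the expected squared norm, which excludes
a maximum of the failure probability there. Gluing extensions with errors tending to zero gives a
stationary strategy that reaches `Z` almost surely (`tendsto_missProb`). -/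

noncomputable section

namespace SeqPersuasion

variable {Ω : Type*} [Fintype Ω]

/-! ### Expectations under an experiment. -/

namespace Experiment

/-- The expectation of a real function of the belief under the experiment. -/
def expect (e : Experiment Ω) (f : Belief Ω → ℝ) : ℝ := ∑ p ∈ e.supp, e.weights p * f p

variable {e : Experiment Ω} {f g : Belief Ω → ℝ} {p q : Belief Ω}

lemma mem_supp : p ∈ e.supp ↔ e.weights p ≠ 0 := Finsupp.mem_support_iff

lemma weights_pos (h : p ∈ e.supp) : 0 < e.weights p :=
  lt_of_le_of_ne (e.nonneg p) (Ne.symm (mem_supp.1 h))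

lemma sum_weights (e : Experiment Ω) : ∑ p ∈ e.supp, e.weights p = 1 := e.total

lemma supp_nonempty (e : Experiment Ω) : e.supp.Nonempty := e.support_weights_nonempty

lemma expect_mono (h : ∀ p ∈ e.supp, f p ≤ g p) : e.expect f ≤ e.expect g :=
  Finset.sum_le_sum fun p hp => mul_le_mul_of_nonneg_left (h p hp) (e.nonneg p)

lemma expect_add : e.expect (fun p => f p + g p) = e.expect f + e.expect g := by
  simp [expect, mul_add, Finset.sum_add_distrib]

lemma expect_sub : e.expect (fun p => f p - g p) = e.expect f - e.expect g := by
  simp [expect, mul_sub, Finset.sum_sub_distrib]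

lemma expect_const_mul (c : ℝ) : e.expect (fun p => c * f p) = c * e.expect f := by
  simp only [expect, Finset.mul_sum]
  exact Finset.sum_congr rfl fun p _ => by ring

@[simp] lemma expect_const (c : ℝ) : e.expect (fun _ => c) = c := by
  simp [expect, ← Finset.sum_mul, sum_weights]

lemma expect_le_const {c : ℝ} (h : ∀ p ∈ e.supp, f p ≤ c) : e.expect f ≤ c :=
  (expect_mono h).trans_eq (expect_const c)

lemma const_le_expect {c : ℝ} (h : ∀ p ∈ e.supp, c ≤ f p) : c ≤ e.expect f :=
  (expect_const c).symm.trans_le (expect_mono h)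

lemma eq_of_expect_eq (h : ∀ p ∈ e.supp, f p ≤ g p) (hfg : e.expect g ≤ e.expect f) :
    ∀ p ∈ e.supp, f p = g p := by
  intro p hp
  have := (Finset.sum_eq_sum_iff_of_le
    fun p hp => mul_le_mul_of_nonneg_left (h p hp) (e.nonneg p)).1
    (le_antisymm (expect_mono h) hfg) p hp
  exact mul_left_cancel₀ (weights_pos hp).ne' this

lemma tendsto_expect {ι : Type*} {l : Filter ι} {F : ι → Belief Ω → ℝ}
    (h : ∀ p ∈ e.supp, Tendsto (fun i => F i p) l (𝓝 (f p))) :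
    Tendsto (fun i => e.expect (F i)) l (𝓝 (e.expect f)) :=
  tendsto_finsetSum _ fun p hp => (h p hp).const_mul _

@[simp] lemma supp_triv (p : Belief Ω) : (triv p).supp = {p} := by
  simp [supp, triv]

@[simp] lemma expect_triv (p : Belief Ω) (f : Belief Ω → ℝ) : (triv p).expect f = f p := by
  simp only [expect, supp_triv, Finset.sum_singleton]
  simp [triv]

lemma mean_apply (e : Experiment Ω) (ω : Ω) :
    (e.mean : Ω → ℝ) ω = e.expect fun q => (q : Ω → ℝ) ω := by
  change (∑ p ∈ e.supp, e.weights p • (p : Ω → ℝ)) ω = _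
  simp [expect]

@[simp] lemma mean_triv (p : Belief Ω) : (triv p).mean = p := by
  ext ω; rw [mean_apply]; simp

lemma triv_mem {F : Set (Experiment Ω)} (hT : trivialExperiments Ω ⊆ F) (p : Belief Ω) :
    triv p ∈ F := hT ⟨p, rfl⟩

lemma ne_triv_of_notMem (h : e ∉ trivialExperiments Ω) (p : Belief Ω) : e ≠ triv p :=
  fun h' => h ⟨p, h'.symm⟩

end Experiment

/-! ### Strict convexity of the squared norm. -/

/-- The squared Euclidean norm of a belief. -/
def sqNorm (p : Belief Ω) : ℝ := ∑ ω, (p : Ω → ℝ) ω ^ 2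

lemma sqNorm_nonneg (p : Belief Ω) : 0 ≤ sqNorm p := Finset.sum_nonneg fun _ _ => sq_nonneg _

lemma sqNorm_le_one (p : Belief Ω) : sqNorm p ≤ 1 := by
  have h1 : ∑ ω, (p : Ω → ℝ) ω = 1 := p.2.2
  rw [← h1]
  refine Finset.sum_le_sum fun ω _ => ?_
  have h0 : 0 ≤ (p : Ω → ℝ) ω := p.2.1 ω
  have : (p : Ω → ℝ) ω ≤ 1 := h1 ▸ Finset.single_le_sum (fun i _ => p.2.1 i) (Finset.mem_univ ω)
  nlinarith

lemma expect_sqNorm_sub (e : Experiment Ω) :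
    e.expect sqNorm - sqNorm e.mean =
      e.expect fun q => ∑ ω, ((q : Ω → ℝ) ω - (e.mean : Ω → ℝ) ω) ^ 2 := by
  have h : ∀ ω, e.expect (fun q => ((q : Ω → ℝ) ω - (e.mean : Ω → ℝ) ω) ^ 2) =
      e.expect (fun q => (q : Ω → ℝ) ω ^ 2) - (e.mean : Ω → ℝ) ω ^ 2 := by
    intro ω
    have : (fun q : Belief Ω => ((q : Ω → ℝ) ω - (e.mean : Ω → ℝ) ω) ^ 2) = fun q : Belief Ω =>
        (q : Ω → ℝ) ω ^ 2 - (2 * (e.mean : Ω → ℝ) ω * (q : Ω → ℝ) ω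
          - (e.mean : Ω → ℝ) ω ^ 2) := by
      ext q; ring
    rw [this, Experiment.expect_sub, Experiment.expect_sub, Experiment.expect_const_mul,
      Experiment.expect_const, ← Experiment.mean_apply]
    ring
  have hs : ∀ f : Ω → Belief Ω → ℝ,
      e.expect (fun q => ∑ ω, f ω q) = ∑ ω, e.expect (f ω) := by
    intro f
    simp only [Experiment.expect, Finset.mul_sum]
    exact Finset.sum_comm
  rw [hs, Finset.sum_congr rfl fun ω _ => h ω, Finset.sum_sub_distrib, ← hs]
  rfl

lemma sqNorm_le_expect (e : Experiment Ω) : sqNorm e.mean ≤ e.expect sqNorm := by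
  have := expect_sqNorm_sub e
  have h0 : 0 ≤ e.expect fun q => ∑ ω, ((q : Ω → ℝ) ω - (e.mean : Ω → ℝ) ω) ^ 2 :=
    Experiment.const_le_expect fun q _ => Finset.sum_nonneg fun _ _ => sq_nonneg _
  linarith

/-- The difference is the variance, which vanishes only if every outcome equals the mean. A small
multiple of `sqNorm` later turns weak submartingale inequalities into strict ones. -/
lemma sqNorm_lt_expect {e : Experiment Ω} (he : e ≠ Experiment.triv e.mean) :
    sqNorm e.mean < e.expect sqNorm := by
  refine lt_of_le_of_ne (sqNorm_le_expect e) fun heq => he ?_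
  have h0 := expect_sqNorm_sub e
  rw [← heq, sub_self] at h0
  have hz := Experiment.eq_of_expect_eq (e := e) (f := fun _ => 0)
    (g := fun q : Belief Ω => ∑ ω, ((q : Ω → ℝ) ω - (e.mean : Ω → ℝ) ω) ^ 2)
    (fun q _ => Finset.sum_nonneg fun _ _ => sq_nonneg _) (by rw [← h0]; simp)
  have hq : ∀ q ∈ e.supp, q = e.mean := by
    intro q hq
    ext ω
    have := (Finset.sum_eq_zero_iff_of_nonneg fun ω _ => sq_nonneg _).1 (hz q hq).symm ω
      (Finset.mem_univ ω)
    exact sub_eq_zero.1 (pow_eq_zero_iff two_ne_zero |>.1 this)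
  have hs : e.supp = {e.mean} :=
    Finset.eq_singleton_iff_nonempty_unique_mem.2 ⟨e.supp_nonempty, hq⟩
  exact Convexity.StdSimplex.support_weights_eq_singleton.1 hs

/-! ### Expectations over histories, termination, realized utility. -/

namespace Rule

variable {φ : Rule Ω} {μ : Belief Ω}

lemma mem_histories_succ {i : ℕ} {η : History Ω (i + 1)} :
    η ∈ φ.histories μ (i + 1) ↔
      ∃ ξ ∈ φ.histories μ i, ∃ p ∈ (φ i ξ).supp, ξ.step (φ i ξ) p = η := by
  simp [histories]

lemma step_mem {i : ℕ} {ξ : History Ω i} (hξ : ξ ∈ φ.histories μ i) {p : Belief Ω}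
    (hp : p ∈ (φ i ξ).supp) : ξ.step (φ i ξ) p ∈ φ.histories μ (i + 1) :=
  mem_histories_succ.2 ⟨ξ, hξ, p, hp, rfl⟩

lemma histories_induction {P : (i : ℕ) → History Ω i → Prop} (h0 : P 0 (History.start μ))
    (hs : ∀ i, ∀ ξ ∈ φ.histories μ i, P i ξ → ∀ p ∈ (φ i ξ).supp, P (i + 1) (ξ.step (φ i ξ) p)) :
    ∀ i, ∀ ξ ∈ φ.histories μ i, P i ξ := by
  intro i
  induction i with
  | zero => simpa [histories] using h0
  | succ i ih =>
    intro η hη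
    obtain ⟨ξ, hξ, p, hp, rfl⟩ := mem_histories_succ.1 hη
    exact hs i ξ hξ (ih ξ hξ) p hp

lemma prob_pos : ∀ i, ∀ ξ ∈ φ.histories μ i, 0 < ξ.prob :=
  histories_induction (by simp [History.prob])
    fun _ _ _ h _ hp => mul_pos h (Experiment.weights_pos hp)

/-- The expectation of a function of the history after `i` steps. -/
def histSum (φ : Rule Ω) (μ : Belief Ω) (i : ℕ) (f : History Ω i → ℝ) : ℝ :=
  ∑ ξ ∈ φ.histories μ i, ξ.prob * f ξ

@[simp] lemma histSum_zero (f : History Ω 0 → ℝ) :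
    φ.histSum μ 0 f = f (History.start μ) := by
  simp [histSum, histories, History.prob]

/-- Tower property. A step records its predecessor, so extensions of distinct histories are
distinct. -/
lemma histSum_succ (i : ℕ) (f : History Ω (i + 1) → ℝ) :
    φ.histSum μ (i + 1) f =
      φ.histSum μ i fun ξ => (φ i ξ).expect fun p => f (ξ.step (φ i ξ) p) := by
  classical
  have hd : ((φ.histories μ i : Set (History Ω i))).PairwiseDisjoint
      fun ξ => (φ i ξ).supp.image fun p => ξ.step (φ i ξ) p := by
    intro ξ _ ξ' _ hne
    rw [Function.onFun, Finset.disjoint_left]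
    intro η h h'
    obtain ⟨p, _, rfl⟩ := Finset.mem_image.1 h
    obtain ⟨p', _, h''⟩ := Finset.mem_image.1 h'
    injection h'' with _ h1
    exact hne h1.symm
  unfold histSum
  rw [show φ.histories μ (i + 1) = (φ.histories μ i).biUnion
    (fun ξ => (φ i ξ).supp.image fun p => ξ.step (φ i ξ) p) by simp only [histories],
    Finset.sum_biUnion hd]
  refine Finset.sum_congr rfl fun ξ _ => ?_
  rw [Finset.sum_image fun p _ p' _ h => by injection h]
  simp only [Experiment.expect, Finset.mul_sum, History.prob, mul_assoc]

lemma histSum_mono {i : ℕ} {f g : History Ω i → ℝ} (h : ∀ ξ ∈ φ.histories μ i, f ξ ≤ g ξ) :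
    φ.histSum μ i f ≤ φ.histSum μ i g :=
  Finset.sum_le_sum fun ξ hξ => mul_le_mul_of_nonneg_left (h ξ hξ) (prob_pos i ξ hξ).le

lemma histSum_congr {i : ℕ} {f g : History Ω i → ℝ} (h : ∀ ξ ∈ φ.histories μ i, f ξ = g ξ) :
    φ.histSum μ i f = φ.histSum μ i g :=
  Finset.sum_congr rfl fun ξ hξ => by rw [h ξ hξ]

lemma histSum_add {i : ℕ} {f g : History Ω i → ℝ} :
    φ.histSum μ i (fun ξ => f ξ + g ξ) = φ.histSum μ i f + φ.histSum μ i g := by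
  simp [histSum, mul_add, Finset.sum_add_distrib]

lemma histSum_sub {i : ℕ} {f g : History Ω i → ℝ} :
    φ.histSum μ i (fun ξ => f ξ - g ξ) = φ.histSum μ i f - φ.histSum μ i g := by
  simp [histSum, mul_sub, Finset.sum_sub_distrib]

lemma histSum_const_mul {i : ℕ} {f : History Ω i → ℝ} (c : ℝ) :
    φ.histSum μ i (fun ξ => c * f ξ) = c * φ.histSum μ i f := by
  simp only [histSum, Finset.mul_sum]
  exact Finset.sum_congr rfl fun p _ => by ring

@[simp] lemma histSum_const (c : ℝ) (i : ℕ) : φ.histSum μ i (fun _ => c) = c := by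
  induction i with
  | zero => simp
  | succ i ih => rw [histSum_succ]; simpa using ih

lemma histSum_nonneg {i : ℕ} {f : History Ω i → ℝ} (h : ∀ ξ ∈ φ.histories μ i, 0 ≤ f ξ) :
    0 ≤ φ.histSum μ i f :=
  Finset.sum_nonneg fun ξ hξ => mul_nonneg (prob_pos i ξ hξ).le (h ξ hξ)

lemma eq_of_histSum_eq {i : ℕ} {f g : History Ω i → ℝ} (h : ∀ ξ ∈ φ.histories μ i, f ξ ≤ g ξ)
    (hfg : φ.histSum μ i g ≤ φ.histSum μ i f) : ∀ ξ ∈ φ.histories μ i, f ξ = g ξ := by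
  intro ξ hξ
  have := (Finset.sum_eq_sum_iff_of_le
    fun ξ hξ => mul_le_mul_of_nonneg_left (h ξ hξ) (prob_pos i ξ hξ).le).1
    (le_antisymm (histSum_mono h) hfg) ξ hξ
  exact mul_left_cancel₀ (prob_pos i ξ hξ).ne' this

/-- The trivial extension of a history by one step, on the type of all histories. -/
def stayOne (x : Σ i, History Ω i) : Σ i, History Ω i :=
  ⟨x.1 + 1, x.2.step (Experiment.triv x.2.last) x.2.last⟩

lemma last_stay {i : ℕ} (ξ : History Ω i) (l : ℕ) : (ξ.stay l).last = ξ.last := by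
  cases l <;> rfl

lemma iterate_stayOne {i : ℕ} (ξ : History Ω i) (l : ℕ) :
    stayOne^[l] ⟨i, ξ⟩ = ⟨i + l, ξ.stay l⟩ := by
  induction l with
  | zero => rfl
  | succ l ih =>
    rw [Function.iterate_succ_apply', ih, stayOne]
    simp only [last_stay]
    rfl

/-- Iterating on the sigma type avoids casts between lengths `i + (l + 1)` and `i + 1 + l`. -/
lemma terminatesAfter_iff {N : ℕ∞} {i : ℕ} {ξ : History Ω i} :
    φ.TerminatesAfter N ξ ↔ ∀ l : ℕ, ((i + l : ℕ) : ℕ∞) < N →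
      φ (stayOne^[l] ⟨i, ξ⟩).1 (stayOne^[l] ⟨i, ξ⟩).2 = Experiment.triv ξ.last := by
  refine forall_congr' fun l => ?_
  rw [iterate_stayOne]

lemma TerminatesAfter.eq_triv {N : ℕ∞} {i : ℕ} {ξ : History Ω i} (h : φ.TerminatesAfter N ξ)
    (hi : (i : ℕ∞) < N) : φ i ξ = Experiment.triv ξ.last := h 0 hi

lemma TerminatesAfter.step {N : ℕ∞} {i : ℕ} {ξ : History Ω i} (h : φ.TerminatesAfter N ξ) :
    φ.TerminatesAfter N (ξ.step (Experiment.triv ξ.last) ξ.last) := by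
  rw [terminatesAfter_iff] at h ⊢
  intro l hl
  exact h (l + 1) (by rwa [show i + (l + 1) = i + 1 + l by omega])

lemma TerminatesAfter.mono {N N' : ℕ∞} {i : ℕ} {ξ : History Ω i} (h : φ.TerminatesAfter N ξ)
    (hN : N' ≤ N) : φ.TerminatesAfter N' ξ := fun l hl => h l (hl.trans_le hN)

lemma IsPersuasion.mono {F : Set (Experiment Ω)} {N N' : ℕ∞} (h : φ.IsPersuasion F μ N)
    (hN : N' ≤ N) : φ.IsPersuasion F μ N' := fun i hi => h i (hi.trans_le hN)

lemma terminatesAfter_of_invariant {T : ℕ → Belief Ω → Prop}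
    (hT : ∀ i p, T i p → T (i + 1) p)
    (hφ : ∀ i (ξ : History Ω i), T i ξ.last → φ i ξ = Experiment.triv ξ.last)
    {N : ℕ∞} {i : ℕ} {ξ : History Ω i} (h : T i ξ.last) : φ.TerminatesAfter N ξ := by
  intro l _
  have : T (i + l) ξ.last := Nat.rec h (fun l ih => hT (i + l) _ ih) l
  simpa [last_stay] using hφ (i + l) (ξ.stay l) (by rwa [last_stay])

open Classical in
/-- The probability that the rule with horizon `N` has not terminated after `n` steps. -/
def probActive (φ : Rule Ω) (μ : Belief Ω) (N : ℕ∞) (n : ℕ) : ℝ :=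
  φ.histSum μ n fun ξ => if φ.TerminatesAfter N ξ then 0 else 1

lemma probTerminates_eq (φ : Rule Ω) (μ : Belief Ω) (N : ℕ∞) (n : ℕ) :
    φ.probTerminates μ N n = 1 - φ.probActive μ N n := by
  classical
  rw [probActive, eq_sub_iff_add_eq, ← histSum_const (φ := φ) (μ := μ) 1 n]
  have : φ.probTerminates μ N n =
      φ.histSum μ n fun ξ => if φ.TerminatesAfter N ξ then 1 else 0 := by
    unfold probTerminates histSum
    exact Finset.sum_congr rfl fun ξ _ => by by_cases h : φ.TerminatesAfter N ξ <;> simp [h]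
  rw [this, ← histSum_add]
  exact histSum_congr fun ξ _ => by split_ifs <;> simp

lemma probActive_nonneg (φ : Rule Ω) (μ : Belief Ω) (N : ℕ∞) (n : ℕ) :
    0 ≤ φ.probActive μ N n :=
  histSum_nonneg fun ξ _ => by split_ifs <;> simp

lemma probActive_succ_le {N : ℕ∞} {n : ℕ} (hn : (n : ℕ∞) < N) :
    φ.probActive μ N (n + 1) ≤ φ.probActive μ N n := by
  classical
  rw [probActive, histSum_succ]
  refine histSum_mono fun ξ _ => ?_
  split_ifs with h
  · rw [h.eq_triv hn, Experiment.expect_triv, if_pos h.step]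
  · exact Experiment.expect_le_const fun p _ => by split_ifs <;> simp

lemma probActive_le_of_le {N : ℕ∞} {m n : ℕ} (hmn : m ≤ n) (hn : (n : ℕ∞) ≤ N) :
    φ.probActive μ N n ≤ φ.probActive μ N m := by
  induction n, hmn using Nat.le_induction with
  | base => exact le_rfl
  | succ n _ ih =>
    have h : (n : ℕ∞) < N := lt_of_lt_of_le (by exact_mod_cast n.lt_succ_self) hn
    exact (probActive_succ_le h).trans (ih h.le)

lemma probActive_mono {N N' : ℕ∞} (hN : N ≤ N') (n : ℕ) :
    φ.probActive μ N n ≤ φ.probActive μ N' n := by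
  classical
  refine histSum_mono fun ξ _ => ?_
  split_ifs with h h' h'
  · exact le_rfl
  · exact zero_le_one
  · exact absurd (h'.mono hN) h
  · exact le_rfl

open Classical in
/-- The utility realized by histories of length `n` after which the rule terminates. -/
def termValue (φ : Rule Ω) (v : Belief Ω → ℝ) (μ : Belief Ω) (n : ℕ) : ℝ :=
  φ.histSum μ n fun ξ => if φ.TerminatesAfter ⊤ ξ then v ξ.last else 0

lemma infValue_eq (φ : Rule Ω) (v : Belief Ω → ℝ) (μ : Belief Ω) :
    φ.infValue v μ = ⨆ n, φ.termValue v μ n := by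
  classical
  unfold infValue termValue histSum
  refine iSup_congr fun n => Finset.sum_congr rfl fun ξ _ => ?_
  by_cases h : φ.TerminatesAfter ⊤ ξ <;> simp [h]

lemma finValue_eq (φ : Rule Ω) (v : Belief Ω → ℝ) (μ : Belief Ω) (n : ℕ) :
    φ.finValue v μ n = φ.histSum μ n fun ξ => v ξ.last := rfl

lemma termValue_le_succ {v : Belief Ω → ℝ} (hv : ∀ p, 0 ≤ v p) (n : ℕ) :
    φ.termValue v μ n ≤ φ.termValue v μ (n + 1) := by
  classical
  rw [termValue, termValue, histSum_succ]
  refine histSum_mono fun ξ _ => ?_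
  split_ifs with h
  · rw [h.eq_triv (by simp), Experiment.expect_triv, if_pos h.step]
    exact le_rfl
  · exact Experiment.const_le_expect fun p _ => by split_ifs <;> simp [hv, History.last]

lemma termValue_mono {v : Belief Ω → ℝ} (hv : ∀ p, 0 ≤ v p) :
    Monotone (φ.termValue v μ) := monotone_nat_of_le_succ (termValue_le_succ hv)

lemma termValue_le_finValue {v : Belief Ω → ℝ} (hv : ∀ p, 0 ≤ v p) (n : ℕ) :
    φ.termValue v μ n ≤ φ.finValue v μ n := by
  classical
  exact histSum_mono fun ξ _ => by split_ifs <;> simp [hv]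

lemma finValue_le {v : Belief Ω → ℝ} {b : ℝ} (hv : ∀ p, v p ≤ b) (n : ℕ) :
    φ.finValue v μ n ≤ b :=
  (histSum_mono fun _ _ => hv _).trans_eq (histSum_const b n)

lemma bddAbove_termValue {v : Belief Ω → ℝ} {b : ℝ} (hv0 : ∀ p, 0 ≤ v p) (hv : ∀ p, v p ≤ b) :
    BddAbove (Set.range (φ.termValue v μ)) :=
  ⟨b, by rintro _ ⟨n, rfl⟩; exact (termValue_le_finValue hv0 n).trans (finValue_le hv n)⟩

end Rule

/-! ### The value function. -/

/-- The supremum of the expected utilities attainable in `n` steps. -/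
def finSup (F : Set (Experiment Ω)) (v : Belief Ω → ℝ) : ℕ → Belief Ω → ℝ
  | 0 => v
  | n + 1 => fun p => sSup {x | ∃ e ∈ F, e.mean = p ∧ e.expect (finSup F v n) = x}

/-- The supremum of the expected utilities attainable in finitely many steps. -/
def supVal (F : Set (Experiment Ω)) (v : Belief Ω → ℝ) (p : Belief Ω) : ℝ := ⨆ n, finSup F v n p

section Value

variable {F : Set (Experiment Ω)} {v : Belief Ω → ℝ} {a b : ℝ}

lemma finSup_le (hT : trivialExperiments Ω ⊆ F) (hv : ∀ p, v p ≤ b) (n : ℕ) (p : Belief Ω) :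
    finSup F v n p ≤ b := by
  induction n generalizing p with
  | zero => exact hv p
  | succ n ih =>
    refine csSup_le ⟨_, _, Experiment.triv_mem hT p, Experiment.mean_triv p, rfl⟩ ?_
    rintro x ⟨e, _, _, rfl⟩
    exact Experiment.expect_le_const fun q _ => ih q

lemma expect_finSup_le (hT : trivialExperiments Ω ⊆ F) (hv : ∀ p, v p ≤ b) (n : ℕ)
    {e : Experiment Ω} (he : e ∈ F) : e.expect (finSup F v n) ≤ finSup F v (n + 1) e.mean := by
  refine le_csSup ⟨b, ?_⟩ ⟨e, he, rfl, rfl⟩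
  rintro x ⟨e, _, _, rfl⟩
  exact Experiment.expect_le_const fun q _ => finSup_le hT hv n q

lemma finSup_le_succ (hT : trivialExperiments Ω ⊆ F) (hv : ∀ p, v p ≤ b) (n : ℕ) (p : Belief Ω) :
    finSup F v n p ≤ finSup F v (n + 1) p := by
  simpa using expect_finSup_le hT hv n (Experiment.triv_mem hT p)

lemma exists_near_finSup (hT : trivialExperiments Ω ⊆ F) {ε : ℝ} (hε : 0 < ε) (n : ℕ)
    (p : Belief Ω) :
    ∃ e ∈ F, e.mean = p ∧ finSup F v (n + 1) p - ε ≤ e.expect (finSup F v n) := by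
  obtain ⟨_, ⟨e, he, hm, rfl⟩, h⟩ := exists_lt_of_lt_csSup
    (s := {x | ∃ e ∈ F, e.mean = p ∧ e.expect (finSup F v n) = x})
    ⟨_, _, Experiment.triv_mem hT p, Experiment.mean_triv p, rfl⟩
    (sub_lt_self (finSup F v (n + 1) p) hε)
  exact ⟨e, he, hm, h.le⟩

lemma finSup_le_supVal (hT : trivialExperiments Ω ⊆ F) (hv : ∀ p, v p ≤ b) (n : ℕ)
    (p : Belief Ω) : finSup F v n p ≤ supVal F v p :=
  le_ciSup (f := fun n => finSup F v n p)
    ⟨b, by rintro _ ⟨n, rfl⟩; exact finSup_le hT hv n p⟩ n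

lemma tendsto_finSup (hT : trivialExperiments Ω ⊆ F) (hv : ∀ p, v p ≤ b) (p : Belief Ω) :
    Tendsto (fun n => finSup F v n p) atTop (𝓝 (supVal F v p)) :=
  tendsto_atTop_ciSup (monotone_nat_of_le_succ fun n => finSup_le_succ hT hv n p)
    ⟨b, by rintro _ ⟨n, rfl⟩; exact finSup_le hT hv n p⟩

lemma le_supVal (hT : trivialExperiments Ω ⊆ F) (hv : ∀ p, v p ≤ b) (p : Belief Ω) :
    v p ≤ supVal F v p := finSup_le_supVal hT hv 0 p

lemma supVal_le (hT : trivialExperiments Ω ⊆ F) (hv : ∀ p, v p ≤ b) (p : Belief Ω) :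
    supVal F v p ≤ b := ciSup_le fun n => finSup_le hT hv n p

/-- The one-step inequality for finite horizons passes to the limit because the support is finite.
-/
lemma expect_supVal_le (hT : trivialExperiments Ω ⊆ F) (hv : ∀ p, v p ≤ b)
    {e : Experiment Ω} (he : e ∈ F) : e.expect (supVal F v) ≤ supVal F v e.mean :=
  le_of_tendsto' (Experiment.tendsto_expect fun p _ => tendsto_finSup hT hv p)
    fun n => (expect_finSup_le hT hv n he).trans (finSup_le_supVal hT hv _ _)

namespace Rule

variable {φ : Rule Ω} {μ : Belief Ω}

lemma finValue_le_finSup (hT : trivialExperiments Ω ⊆ F) (hv : ∀ p, v p ≤ b) {n : ℕ}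
    (hφ : φ.IsPersuasion F μ n) : φ.finValue v μ n ≤ finSup F v n μ := by
  have key : ∀ i ≤ n, φ.histSum μ i (fun ξ => finSup F v (n - i) ξ.last) ≤ finSup F v n μ := by
    intro i
    induction i with
    | zero => simp [History.last]
    | succ i ih =>
      intro hi
      refine le_trans ?_ (ih (by omega))
      rw [histSum_succ]
      refine histSum_mono fun ξ hξ => ?_
      obtain ⟨hF, hm⟩ := hφ i (by exact_mod_cast hi) ξ hξ
      rw [← hm, show n - i = n - (i + 1) + 1 by omega]
      exact expect_finSup_le hT hv _ hF
  simpa [finValue_eq, finSup] using key n le_rfl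

lemma infValue_le_supVal (hT : trivialExperiments Ω ⊆ F) (hv0 : ∀ p, 0 ≤ v p)
    (hv : ∀ p, v p ≤ b) (hφ : φ.IsPersuasion F μ ⊤) : φ.infValue v μ ≤ supVal F v μ := by
  rw [infValue_eq]
  exact ciSup_le fun n => (termValue_le_finValue hv0 n).trans
    ((finValue_le_finSup hT hv (hφ.mono le_top)).trans (finSup_le_supVal hT hv n μ))

open Classical in
/-- A potential that does not decrease in expectation, is bounded by the utility when the rule stops,
and is bounded above, is a lower bound of the expected utility of a rule that stops almost surely. -/
lemma le_infValue (hv0 : ∀ p, 0 ≤ v p) (hv : ∀ p, v p ≤ b) {T : ℕ → Belief Ω → Prop}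
    (Φ : ℕ → Belief Ω → ℝ) {c : ℝ} (hΦ : ∀ i p, Φ i p ≤ c)
    (hstep : ∀ i, ∀ ξ ∈ φ.histories μ i, Φ i ξ.last ≤ (φ i ξ).expect (Φ (i + 1)))
    (hterm : ∀ i (ξ : History Ω i), T i ξ.last → φ.TerminatesAfter ⊤ ξ ∧ Φ i ξ.last ≤ v ξ.last)
    (hT : Tendsto (fun n => φ.histSum μ n fun ξ => if T n ξ.last then 0 else 1) atTop (𝓝 0)) :
    Φ 0 μ ≤ φ.infValue v μ := by
  have hΦn : ∀ n, Φ 0 μ ≤ φ.histSum μ n fun ξ => Φ n ξ.last := by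
    intro n
    induction n with
    | zero => simp [History.last]
    | succ n ih =>
      rw [histSum_succ]
      exact ih.trans (histSum_mono (hstep n))
  -- Histories that have not stopped contribute at most `c` times their probability to the
  -- potential.
  have key : ∀ n, Φ 0 μ - c * (φ.histSum μ n fun ξ => if T n ξ.last then 0 else 1) ≤
      φ.infValue v μ := by
    intro n
    rw [infValue_eq]
    refine le_trans ?_ (le_ciSup (bddAbove_termValue hv0 hv) n)
    refine (sub_le_sub_right (hΦn n) _).trans ?_
    rw [← histSum_const_mul, ← histSum_sub]
    refine histSum_mono fun ξ _ => ?_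
    by_cases h : T n ξ.last
    · simp [h, (hterm n ξ h).1, (hterm n ξ h).2]
    · have h0 : (0 : ℝ) ≤ if φ.TerminatesAfter ⊤ ξ then v ξ.last else 0 := by
        split_ifs <;> simp [hv0]
      have := hΦ n ξ.last
      simp only [h, if_false]
      linarith
  have hlim := (hT.const_mul c).const_sub (Φ 0 μ)
  rw [mul_zero, sub_zero] at hlim
  exact le_of_tendsto' hlim key

end Rule

/-- An infinite rule plays `n` steps, each optimal up to `ε`, then stops. Its potential is the
optimal value of the remaining steps minus `ε` for each of them. -/
lemma finSup_le_vInf (hT : trivialExperiments Ω ⊆ F) (hv0 : ∀ p, 0 ≤ v p) (hv : ∀ p, v p ≤ b)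
    (n : ℕ) (μ : Belief Ω) : finSup F v n μ ≤ vInf F v μ := by
  classical
  have hbdd : BddAbove {x | ∃ φ : Rule Ω, φ.IsPersuasion F μ ⊤ ∧ φ.infValue v μ = x} :=
    ⟨supVal F v μ, by rintro _ ⟨φ, hφ, rfl⟩; exact Rule.infValue_le_supVal hT hv0 hv hφ⟩
  refine le_of_forall_pos_le_add fun δ hδ => ?_
  obtain ⟨ε, hε, hεδ⟩ : ∃ ε > 0, n * ε ≤ δ :=
    ⟨δ / (n + 1), by positivity, by
      rw [mul_div_assoc', div_le_iff₀ (by positivity)]; nlinarith⟩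
  choose act hact using fun (n : ℕ) (p : Belief Ω) => exists_near_finSup (v := v) hT hε n p
  let φ : Rule Ω := fun i ξ => if i < n then act (n - i - 1) ξ.last else Experiment.triv ξ.last
  have hφ : φ.IsPersuasion F μ ⊤ := by
    intro i _ ξ _
    by_cases h : i < n
    · simp only [φ, h, if_true]; exact ⟨(hact _ _).1, (hact _ _).2.1⟩
    · simp only [φ, h, if_false]; exact ⟨Experiment.triv_mem hT _, Experiment.mean_triv _⟩
  have hval : finSup F v n μ - n * ε ≤ φ.infValue v μ := by
    have := Rule.le_infValue (φ := φ) (μ := μ) hv0 hv (T := fun i _ => n ≤ i)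
      (fun i p => finSup F v (n - i) p - (n - i : ℕ) * ε) (c := b) ?_ ?_ ?_ ?_
    · simpa using this
    · intro i p
      have := finSup_le hT hv (n - i) p
      have h' : 0 ≤ ((n - i : ℕ) : ℝ) * ε := by positivity
      linarith
    · intro i ξ _
      by_cases h : i < n
      · simp only [φ, h, if_true]
        rw [Experiment.expect_sub, Experiment.expect_const]
        have h1 := (hact (n - i - 1) ξ.last).2.2
        rw [show n - i - 1 + 1 = n - i by omega, show n - i - 1 = n - (i + 1) by omega] at h1
        have h2 : ((n - i : ℕ) : ℝ) = (n - (i + 1) : ℕ) + 1 := by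
          rw [show n - i = n - (i + 1) + 1 by omega]; push_cast; ring
        rw [h2, show n - i - 1 = n - (i + 1) by omega]
        linarith
      · simp only [φ, h, if_false]
        rw [Experiment.expect_triv, show n - i = 0 by omega, show n - (i + 1) = 0 by omega]
    · intro i ξ h
      refine ⟨Rule.terminatesAfter_of_invariant (T := fun i _ => n ≤ i)
        (fun i _ h => Nat.le_succ_of_le h) (fun i ξ h => ?_) h, ?_⟩
      · simp [φ, not_lt.2 h]
      · simp [Nat.sub_eq_zero_of_le h, finSup]
    · refine tendsto_const_nhds.congr' ?_
      filter_upwards [eventually_ge_atTop n] with m hm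
      simp [hm]
  have := le_csSup hbdd ⟨φ, hφ, rfl⟩
  have h2 : φ.infValue v μ ≤ vInf F v μ := this
  linarith

lemma vInf_eq_supVal (hT : trivialExperiments Ω ⊆ F) (hv0 : ∀ p, 0 ≤ v p) (hv : ∀ p, v p ≤ b)
    (μ : Belief Ω) : vInf F v μ = supVal F v μ := by
  refine le_antisymm (csSup_le ⟨_, fun _ ξ => Experiment.triv ξ.last, fun i _ ξ _ =>
    ⟨Experiment.triv_mem hT _, Experiment.mean_triv _⟩, rfl⟩ ?_)
    (ciSup_le fun n => finSup_le_vInf hT hv0 hv n μ)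
  rintro _ ⟨φ, hφ, rfl⟩
  exact Rule.infValue_le_supVal hT hv0 hv hφ

/-! ### Optimal persuasions -/

section Optimal

variable {φ : Rule Ω} {μ : Belief Ω}

lemma IsOptimal.tendsto_termValue (hv0 : ∀ p, 0 ≤ v p) (hv : ∀ p, v p ≤ b)
    (hφ : IsOptimal F v μ φ) :
    Tendsto (φ.termValue v μ) atTop (𝓝 (vInf F v μ)) := by
  rw [← hφ.2, Rule.infValue_eq]
  exact tendsto_atTop_ciSup (Rule.termValue_mono hv0) (Rule.bddAbove_termValue hv0 hv)

lemma histSum_supVal_succ_le (hT : trivialExperiments Ω ⊆ F) (hv : ∀ p, v p ≤ b)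
    (hφ : φ.IsPersuasion F μ ⊤) (n : ℕ) :
    (φ.histSum μ (n + 1) fun ξ => supVal F v ξ.last) ≤ φ.histSum μ n fun ξ => supVal F v ξ.last := by
  rw [Rule.histSum_succ]
  refine Rule.histSum_mono fun ξ hξ => ?_
  obtain ⟨hF, hm⟩ := hφ n (by simp) ξ hξ
  simpa only [hm, History.last] using expect_supVal_le hT hv hF

lemma histSum_supVal_le (hT : trivialExperiments Ω ⊆ F) (hv : ∀ p, v p ≤ b)
    (hφ : φ.IsPersuasion F μ ⊤) (n : ℕ) :
    (φ.histSum μ n fun ξ => supVal F v ξ.last) ≤ supVal F v μ := by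
  induction n with
  | zero => simp [History.last]
  | succ n ih => exact (histSum_supVal_succ_le hT hv hφ n).trans ih

lemma termValue_add_probActive_le (hT : trivialExperiments Ω ⊆ F) (ha : ∀ p, a ≤ v p)
    (hv : ∀ p, v p ≤ b) (n : ℕ) :
    φ.termValue v μ n + a * φ.probActive μ ⊤ n ≤
      φ.histSum μ n fun ξ => supVal F v ξ.last := by
  classical
  rw [Rule.probActive, ← Rule.histSum_const_mul, Rule.termValue, ← Rule.histSum_add]
  refine Rule.histSum_mono fun ξ _ => ?_
  have h1 := le_supVal hT hv ξ.last
  by_cases h : φ.TerminatesAfter ⊤ ξ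
  · simpa [h] using h1
  · simpa [h] using (ha _).trans h1

/-- Active histories still carry `U ≥ a > 0`, so realized utility falls short of `U μ` by at least
`a` times their probability; at an optimum this shortfall tends to zero. -/
lemma IsOptimal.tendsto_probActive (hT : trivialExperiments Ω ⊆ F) (ha0 : 0 < a)
    (ha : ∀ p, a ≤ v p) (hv : ∀ p, v p ≤ b) (hφ : IsOptimal F v μ φ) :
    Tendsto (φ.probActive μ ⊤) atTop (𝓝 0) := by
  have hv0 : ∀ p, 0 ≤ v p := fun p => ha0.le.trans (ha p)
  have h1 := hφ.tendsto_termValue hv0 hv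
  have h2 : Tendsto (fun n => (vInf F v μ - φ.termValue v μ n) / a) atTop (𝓝 0) := by
    simpa using (h1.const_sub (vInf F v μ)).div_const a
  refine squeeze_zero (fun n => Rule.probActive_nonneg _ _ _ _) (fun n => ?_) h2
  rw [le_div_iff₀ ha0, vInf_eq_supVal hT hv0 hv]
  have := termValue_add_probActive_le (φ := φ) (μ := μ) hT ha hv n
  have := histSum_supVal_le hT hv hφ.1 n
  linarith

/-- The expectation of `U` decreases in time from `U μ`, yet stays above the realized utility, which
tends to `U μ`. -/
lemma IsOptimal.histSum_supVal (hT : trivialExperiments Ω ⊆ F) (hv0 : ∀ p, 0 ≤ v p)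
    (hv : ∀ p, v p ≤ b) (hφ : IsOptimal F v μ φ) (n : ℕ) :
    (φ.histSum μ n fun ξ => supVal F v ξ.last) = supVal F v μ := by
  refine le_antisymm (histSum_supVal_le hT hv hφ.1 n) ?_
  rw [← vInf_eq_supVal hT hv0 hv]
  refine le_of_tendsto (hφ.tendsto_termValue hv0 hv) ?_
  filter_upwards [eventually_ge_atTop n] with m hm
  have h1 : φ.termValue v μ m ≤ φ.histSum μ m fun ξ => supVal F v ξ.last := by
    simpa using termValue_add_probActive_le (φ := φ) (μ := μ) hT hv0 hv m
  have h2 : Antitone fun n => φ.histSum μ n fun ξ => supVal F v ξ.last :=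
    antitone_nat_of_succ_le (histSum_supVal_succ_le hT hv hφ.1)
  exact h1.trans (h2 hm)

lemma IsOptimal.expect_supVal (hT : trivialExperiments Ω ⊆ F) (hv0 : ∀ p, 0 ≤ v p)
    (hv : ∀ p, v p ≤ b) (hφ : IsOptimal F v μ φ) {i : ℕ} {ξ : History Ω i}
    (hξ : ξ ∈ φ.histories μ i) : (φ i ξ).expect (supVal F v) = supVal F v ξ.last := by
  refine Rule.eq_of_histSum_eq (f := fun ξ => (φ i ξ).expect (supVal F v))
    (g := fun ξ => supVal F v ξ.last) (fun ξ hξ => ?_) ?_ ξ hξ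
  · obtain ⟨hF, hm⟩ := hφ.1 i (by simp) ξ hξ
    simpa only [hm] using expect_supVal_le hT hv hF
  · rw [hφ.histSum_supVal hT hv0 hv, ← hφ.histSum_supVal hT hv0 hv (i + 1), Rule.histSum_succ]
    exact le_rfl

/-- The expected gap `U - v` over terminated histories never shrinks, since they stay put, but it is
at most `U μ` minus the realized utility, which tends to zero. -/
lemma IsOptimal.eq_supVal_of_terminatesAfter (hT : trivialExperiments Ω ⊆ F) (hv0 : ∀ p, 0 ≤ v p)
    (hv : ∀ p, v p ≤ b) (hφ : IsOptimal F v μ φ) {i : ℕ} {ξ : History Ω i}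
    (hξ : ξ ∈ φ.histories μ i) (ht : φ.TerminatesAfter ⊤ ξ) : v ξ.last = supVal F v ξ.last := by
  classical
  let f : (i : ℕ) → History Ω i → ℝ := fun i ξ =>
    if φ.TerminatesAfter ⊤ ξ then supVal F v ξ.last - v ξ.last else 0
  have hf0 : ∀ i ξ, 0 ≤ f i ξ := fun i ξ => by
    simp only [f]; split_ifs
    · exact sub_nonneg.2 (le_supVal hT hv _)
    · exact le_rfl
  have hmono : Monotone fun n => φ.histSum μ n (f n) := by
    refine monotone_nat_of_le_succ fun n => ?_
    rw [Rule.histSum_succ]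
    refine Rule.histSum_mono fun ξ _ => ?_
    by_cases h : φ.TerminatesAfter ⊤ ξ
    · rw [h.eq_triv (by simp), Experiment.expect_triv]
      simp only [f, h, h.step, if_true]
      exact le_rfl
    · simp only [f, h, if_false]
      exact Experiment.const_le_expect fun p _ => hf0 _ _
  have hle : ∀ n, φ.histSum μ n (f n) ≤ supVal F v μ - φ.termValue v μ n := by
    intro n
    rw [← hφ.histSum_supVal hT hv0 hv n, Rule.termValue, ← Rule.histSum_sub]
    refine Rule.histSum_mono fun ξ _ => ?_
    by_cases h : φ.TerminatesAfter ⊤ ξ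
    · simp [f, h]
    · simpa [f, h] using (hv0 _).trans (le_supVal hT hv _)
  have hz : φ.histSum μ i (f i) ≤ 0 := by
    refine ge_of_tendsto (f := fun n => supVal F v μ - φ.termValue v μ n) (x := atTop) ?_ ?_
    · rw [← sub_self (supVal F v μ)]
      nth_rewrite 3 [← vInf_eq_supVal hT hv0 hv]
      exact (hφ.tendsto_termValue hv0 hv).const_sub _
    · filter_upwards [eventually_ge_atTop i] with n hn
      exact (hmono hn).trans (hle n)
  have := Rule.eq_of_histSum_eq (f := fun _ => 0) (g := f i) (fun ξ _ => hf0 i ξ)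
    (by simpa using hz) ξ hξ
  simp only [f, ht, if_true] at this
  linarith

/-- The truncations of an optimal persuasion terminate uniformly. -/
theorem IsOptimal.uniformTermination (hT : trivialExperiments Ω ⊆ F) (ha0 : 0 < a)
    (ha : ∀ p, a ≤ v p) (hv : ∀ p, v p ≤ b) (hφ : IsOptimal F v μ φ) :
    UniformTermination F v μ := by
  have hv0 : ∀ p, 0 ≤ v p := fun p => ha0.le.trans (ha p)
  refine ⟨id, fun _ => φ, fun k => hφ.1.mono le_top, ?_, fun ε hε => ?_⟩
  · refine tendsto_of_tendsto_of_tendsto_of_le_of_le (hφ.tendsto_termValue hv0 hv)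
      tendsto_const_nhds (Rule.termValue_le_finValue hv0) fun n => ?_
    rw [vInf_eq_supVal hT hv0 hv]
    exact (Rule.finValue_le_finSup hT hv (hφ.1.mono le_top)).trans (finSup_le_supVal hT hv n μ)
  -- A shorter horizon only makes termination easier, so the time found for the infinite rule serves
  -- all truncations.
  · obtain ⟨m, hm⟩ := ((hφ.tendsto_probActive hT ha0 ha hv).eventually_lt_const hε).exists
    refine ⟨m, fun k _ => ?_⟩
    have : φ.probActive μ ((id k : ℕ) : ℕ∞) m ≤ φ.probActive μ ⊤ m := Rule.probActive_mono le_top m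
    rw [Rule.probTerminates_eq]
    linarith

end Optimal

end Value

/-! ### Limits of experiments -/

lemma Experiment.integral_toProb (e : Experiment Ω) (f : Belief Ω → ℝ) :
    ∫ p, f p ∂(e.toProb : Measure (Belief Ω)) = e.expect f := by
  change ∫ p, f p ∂(∑ p ∈ e.supp, ENNReal.ofReal (e.weights p) • Measure.dirac p) = _
  rw [integral_finsetSum_measure fun p _ =>
    (integrable_dirac (by simp)).smul_measure ENNReal.ofReal_ne_top]
  refine Finset.sum_congr rfl fun p _ => ?_
  rw [integral_smul_measure, integral_dirac, ENNReal.toReal_ofReal (e.nonneg p), smul_eq_mul]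

/-- A common number of slots puts all experiments into one compact space. Unused slots have weight
zero and an arbitrary belief of the support. -/
lemma Experiment.exists_enum (e : Experiment Ω) {h : ℕ} (he : e.supp.card ≤ h) :
    ∃ (w : Fin h → ℝ) (q : Fin h → Belief Ω), (∀ j, 0 ≤ w j) ∧ (∀ j, q j ∈ e.supp) ∧
      ∀ f, e.expect f = ∑ j, w j * f (q j) := by
  classical
  obtain ⟨p₀, hp₀⟩ := e.supp_nonempty
  obtain ⟨g⟩ : Nonempty (e.supp ↪ Fin h) :=
    Function.Embedding.nonempty_of_card_le (by simpa using he)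
  refine ⟨fun j => ∑ p : e.supp, if g p = j then e.weights p else 0,
    fun j => if hj : ∃ p, g p = j then hj.choose else p₀, fun j => ?_, fun j => ?_, fun f => ?_⟩
  · exact Finset.sum_nonneg fun p _ => by split_ifs; exacts [e.nonneg _, le_rfl]
  · dsimp only
    split_ifs with hj
    exacts [hj.choose.2, hp₀]
  · simp only [Finset.sum_mul]
    rw [Finset.sum_comm, Experiment.expect, ← Finset.sum_coe_sort]
    refine Finset.sum_congr rfl fun p _ => ?_
    rw [Finset.sum_eq_single (g p) (fun j _ hj => by simp [Ne.symm hj]) (by simp)]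
    have hj : ∃ p', g p' = g p := ⟨p, rfl⟩
    rw [dif_pos hj, g.injective hj.choose_spec, if_pos rfl]

/-- Convergence of atoms and weights implies weak convergence. The resulting equality of measures
then gives the formula for every `f`, continuous or not. -/
lemma ClosedFeasible.exists_limit {F : Set (Experiment Ω)} (hF : ClosedFeasible F)
    {ι : Type*} [Fintype ι] {e : ℕ → Experiment Ω} (he : ∀ k, e k ∈ F)
    {w : ℕ → ι → ℝ} {q : ℕ → ι → Belief Ω} (hw : ∀ k j, 0 ≤ w k j)
    (hexp : ∀ k f, (e k).expect f = ∑ j, w k j * f (q k j))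
    {w₀ : ι → ℝ} {q₀ : ι → Belief Ω} (hw₀ : ∀ j, Tendsto (fun k => w k j) atTop (𝓝 (w₀ j)))
    (hq₀ : ∀ j, Tendsto (fun k => q k j) atTop (𝓝 (q₀ j))) :
    ∃ e' ∈ F, ∀ f, e'.expect f = ∑ j, w₀ j * f (q₀ j) := by
  have hpos : ∀ j, 0 ≤ w₀ j := fun j => ge_of_tendsto' (hw₀ j) fun k => hw k j
  have hsum : ∑ j, w₀ j = 1 := by
    refine tendsto_nhds_unique (tendsto_finsetSum _ fun j _ => hw₀ j) ?_
    have : ∀ k, ∑ j, w k j = 1 := fun k => by simpa using (hexp k fun _ => 1).symm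
    simp [this]
  let Q : ProbabilityMeasure (Belief Ω) :=
    ⟨∑ j, ENNReal.ofReal (w₀ j) • Measure.dirac (q₀ j), ⟨by
      simp [← ENNReal.ofReal_sum_of_nonneg (fun j _ => hpos j), hsum]⟩⟩
  have hQ : ∀ f : Belief Ω → ℝ, ∫ p, f p ∂(Q : Measure (Belief Ω)) = ∑ j, w₀ j * f (q₀ j) := by
    intro f
    change ∫ p, f p ∂(∑ j, ENNReal.ofReal (w₀ j) • Measure.dirac (q₀ j)) = _
    rw [integral_finsetSum_measure fun p _ =>
      (integrable_dirac (by simp)).smul_measure ENNReal.ofReal_ne_top]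
    refine Finset.sum_congr rfl fun j _ => ?_
    rw [integral_smul_measure, integral_dirac, ENNReal.toReal_ofReal (hpos j), smul_eq_mul]
  obtain ⟨e', he', heQ⟩ := hF.2 e Q he <| by
    rw [ProbabilityMeasure.tendsto_iff_forall_integral_tendsto]
    intro f
    simp only [Experiment.integral_toProb, hQ, hexp]
    exact tendsto_finsetSum _ fun j _ => (hw₀ j).mul ((f.continuous.tendsto _).comp (hq₀ j))
  exact ⟨e', he', fun f => by rw [← Experiment.integral_toProb, heQ, hQ]⟩

/-! ### Attainable pairs of utility and cost -/

/-- From `p` at time `t` some finite persuasion has expected utility `x` and expected cost `y`, where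
stopping at time `s` costs `c s`. -/
inductive Reach (F : Set (Experiment Ω)) (v : Belief Ω → ℝ) (c : ℕ → ℝ) :
    ℕ → Belief Ω → ℝ → ℝ → Prop
  | halt (t : ℕ) (p : Belief Ω) : Reach F v c t p (v p) (c t)
  | step (t : ℕ) (e : Experiment Ω) (he : e ∈ F) (X Y : Belief Ω → ℝ)
      (h : ∀ q ∈ e.supp, Reach F v c (t + 1) q (X q) (Y q)) :
      Reach F v c t e.mean (e.expect X) (e.expect Y)

/-- Limits of the attainable triples of belief, utility and cost. -/
def ReachLim (F : Set (Experiment Ω)) (v : Belief Ω → ℝ) (c : ℕ → ℝ) (t : ℕ) (p : Belief Ω)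
    (x y : ℝ) : Prop :=
  ∃ (ps : ℕ → Belief Ω) (xs ys : ℕ → ℝ), (∀ k, Reach F v c t (ps k) (xs k) (ys k)) ∧
    Tendsto ps atTop (𝓝 p) ∧ Tendsto xs atTop (𝓝 x) ∧ Tendsto ys atTop (𝓝 y)

section Reach

variable {F : Set (Experiment Ω)} {v : Belief Ω → ℝ} {c : ℕ → ℝ} {a b : ℝ} {t : ℕ}
  {p : Belief Ω} {x y : ℝ}

lemma Reach.le_utility (ha : ∀ p, a ≤ v p) (h : Reach F v c t p x y) : a ≤ x := by
  induction h with
  | halt t p => exact ha p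
  | step t e he X Y h ih => exact Experiment.const_le_expect ih

lemma Reach.utility_le (hv : ∀ p, v p ≤ b) (h : Reach F v c t p x y) : x ≤ b := by
  induction h with
  | halt t p => exact hv p
  | step t e he X Y h ih => exact Experiment.expect_le_const ih

lemma Reach.le_cost (hc : Monotone c) (h : Reach F v c t p x y) : c t ≤ y := by
  induction h with
  | halt t p => exact le_rfl
  | step t e he X Y h ih =>
    exact Experiment.const_le_expect fun q hq => (hc t.le_succ).trans (ih q hq)

lemma ReachLim.utility_le (hv : ∀ p, v p ≤ b) (h : ReachLim F v c t p x y) : x ≤ b := by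
  obtain ⟨ps, xs, ys, hr, -, hx, -⟩ := h
  exact le_of_tendsto' hx fun k => (hr k).utility_le hv

lemma ReachLim.le_cost (hc : Monotone c) (h : ReachLim F v c t p x y) : c t ≤ y := by
  obtain ⟨ps, xs, ys, hr, -, -, hy⟩ := h
  exact ge_of_tendsto' hy fun k => (hr k).le_cost hc

/-- A limit triple is dominated by stopping, or splits into limit triples of the next period. -/
lemma ReachLim.halt_or_step (hF : ClosedFeasible F) (husc : UpperSemicontinuous v)
    (ha : ∀ p, a ≤ v p) (hv : ∀ p, v p ≤ b) (hc : Monotone c) (hc0 : ∀ t, 0 ≤ c t)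
    (h : ReachLim F v c t p x y) :
    x ≤ v p ∨ ∃ e ∈ F, e.mean = p ∧ ∃ (n : ℕ) (w : Fin n → ℝ) (q : Fin n → Belief Ω)
      (X Y : Fin n → ℝ), (∀ j, 0 ≤ w j) ∧ (∀ f, e.expect f = ∑ j, w j * f (q j)) ∧
      (∀ j, 0 < w j → ReachLim F v c (t + 1) (q j) (X j) (Y j)) ∧
      ∑ j, w j * X j = x ∧ ∑ j, w j * Y j ≤ y := by
  obtain ⟨ps, xs, ys, hr, hp, hx, hy⟩ := h
  by_cases hhalt : ∃ᶠ k in atTop, xs k = v (ps k)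
  · left
    by_contra! hlt
    obtain ⟨m, hm1, hm2⟩ := exists_between hlt
    have h1 : ∀ᶠ k in atTop, v (ps k) < m := hp.eventually (husc p m hm1)
    obtain ⟨k, hk, hk1, hk2⟩ :=
      (hhalt.and_eventually (h1.and (hx.eventually_const_lt hm2))).exists
    linarith
  right
  obtain ⟨N, hN⟩ := eventually_atTop.1 (not_frequently.1 hhalt)
  have hstep : ∀ k, ∃ e ∈ F, ∃ X Y : Belief Ω → ℝ,
      (∀ q ∈ e.supp, Reach F v c (t + 1) q (X q) (Y q)) ∧
      e.mean = ps (k + N) ∧ e.expect X = xs (k + N) ∧ e.expect Y = ys (k + N) := by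
    intro k
    have h1 := hr (k + N)
    have h2 := hN (k + N) (by omega)
    generalize ps (k + N) = p' at h1 h2
    generalize xs (k + N) = x' at h1 h2
    generalize ys (k + N) = y' at h1 h2
    cases h1 with
    | halt => exact absurd rfl h2
    | step _ e he X Y h => exact ⟨e, he, X, Y, h, rfl, rfl, rfl⟩
  choose e he X Y hXY hm hX hY using hstep
  obtain ⟨n, hn⟩ := hF.1
  choose w q hw hq hexp using fun k => (e k).exists_enum (hn _ (he k))
  -- Costs of single outcomes may be unbounded as their weights vanish; the products of weight and
  -- cost lie in `[0, C]`, so compactness is applied to these.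
  obtain ⟨C, hC⟩ := (hy.comp (tendsto_add_atTop_nat N)).bddAbove_range
  have hw1 : ∀ k j, w k j ≤ 1 := by
    intro k j
    have h1 : ∑ j, w k j = 1 := by simpa using (hexp k fun _ => 1).symm
    exact h1 ▸ Finset.single_le_sum (fun i _ => hw k i) (Finset.mem_univ j)
  have hz0 : ∀ k j, 0 ≤ w k j * Y k (q k j) := fun k j =>
    mul_nonneg (hw k j) ((hc0 _).trans ((hXY k _ (hq k j)).le_cost hc))
  have hzC : ∀ k j, w k j * Y k (q k j) ≤ C := by
    intro k j
    refine le_trans ?_ (hC ⟨k, rfl⟩)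
    simp only [Function.comp]
    rw [← hY, hexp]
    exact Finset.single_le_sum (f := fun j => w k j * Y k (q k j)) (fun i _ => hz0 k i)
      (Finset.mem_univ j)
  have hcomp : IsCompact (Set.univ.pi fun _ : Fin n =>
      Set.Icc (0 : ℝ) 1 ×ˢ (Set.univ : Set (Belief Ω)) ×ˢ Set.Icc a b ×ˢ Set.Icc 0 C) :=
    isCompact_univ_pi fun _ =>
      isCompact_Icc.prod (isCompact_univ.prod (isCompact_Icc.prod isCompact_Icc))
  obtain ⟨l, hl, σ, hσ, hlim⟩ := hcomp.tendsto_subseq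
    (x := fun k j => (w k j, q k j, X k (q k j), w k j * Y k (q k j)))
    (fun k j _ => ⟨⟨hw k j, hw1 k j⟩, trivial,
      ⟨(hXY k _ (hq k j)).le_utility ha, (hXY k _ (hq k j)).utility_le hv⟩, hz0 k j, hzC k j⟩)
  have hl' := fun j => tendsto_pi_nhds.1 hlim j
  have hlw : ∀ j, Tendsto (fun k => w (σ k) j) atTop (𝓝 (l j).1) := fun j => (hl' j).fst_nhds
  have hlq : ∀ j, Tendsto (fun k => q (σ k) j) atTop (𝓝 (l j).2.1) :=
    fun j => (hl' j).snd_nhds.fst_nhds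
  have hlX : ∀ j, Tendsto (fun k => X (σ k) (q (σ k) j)) atTop (𝓝 (l j).2.2.1) :=
    fun j => (hl' j).snd_nhds.snd_nhds.fst_nhds
  have hlz : ∀ j, Tendsto (fun k => w (σ k) j * Y (σ k) (q (σ k) j)) atTop (𝓝 (l j).2.2.2) :=
    fun j => (hl' j).snd_nhds.snd_nhds.snd_nhds
  have hσN : Tendsto (fun k => σ k + N) atTop atTop :=
    (tendsto_add_atTop_nat N).comp hσ.tendsto_atTop
  obtain ⟨e', he', hexp'⟩ := hF.exists_limit (fun k => he (σ k)) (fun k => hw (σ k))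
    (fun k => hexp (σ k)) hlw hlq
  have hlpos : ∀ j, 0 ≤ (l j).1 := fun j => (hl j trivial).1.1
  refine ⟨e', he', ?_, n, fun j => (l j).1, fun j => (l j).2.1, fun j => (l j).2.2.1,
    fun j => (l j).2.2.2 / (l j).1, hlpos, hexp', fun j hj => ?_, ?_, ?_⟩
  · ext ω
    rw [Experiment.mean_apply, hexp']
    have hcont : Continuous fun p : Belief Ω => (p : Ω → ℝ) ω :=
      (continuous_apply ω).comp continuous_subtype_val
    refine tendsto_nhds_unique (tendsto_finsetSum _ fun j _ =>
      (hlw j).mul ((hcont.tendsto _).comp (hlq j))) ?_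
    refine ((hcont.tendsto p).comp (hp.comp hσN)).congr fun k => ?_
    simp only [Function.comp, ← hm, Experiment.mean_apply, hexp]
  · refine ⟨fun k => q (σ k) j, fun k => X (σ k) (q (σ k) j), fun k => Y (σ k) (q (σ k) j),
      fun k => hXY _ _ (hq _ _), hlq j, hlX j, ?_⟩
    refine ((hlz j).div (hlw j) hj.ne').congr' ?_
    filter_upwards [(hlw j).eventually_const_lt hj] with k hk
    exact mul_div_cancel_left₀ _ hk.ne'
  · refine tendsto_nhds_unique (tendsto_finsetSum _ fun j _ => (hlw j).mul (hlX j)) ?_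
    refine (hx.comp hσN).congr fun k => ?_
    simp only [Function.comp, ← hX, hexp]
  -- Cost carried by outcomes whose weight vanishes in the limit is dropped, whence only an
  -- inequality.
  · have h1 : ∑ j, (l j).2.2.2 = y := by
      refine tendsto_nhds_unique (tendsto_finsetSum _ fun j _ => hlz j) ?_
      refine (hy.comp hσN).congr fun k => ?_
      simp only [Function.comp, ← hY, hexp]
    rw [← h1]
    refine Finset.sum_le_sum fun j _ => ?_
    dsimp only
    rcases (hlpos j).eq_or_lt with h0 | h0
    · rw [← h0, zero_mul]; exact (hl j trivial).2.2.2.1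
    · rw [mul_div_cancel₀ _ h0.ne']

/-- Mass still active at time `t + n` has utility at most `b` and cost at least `c (t + n)`, so the
penalty cancels its utility and it may be cut off. -/
lemma ReachLim.sub_le_finSup (hT : trivialExperiments Ω ⊆ F) (hF : ClosedFeasible F)
    (husc : UpperSemicontinuous v) (hv0 : ∀ p, 0 ≤ v p) (hv : ∀ p, v p ≤ b) (hc : Monotone c)
    (hc0 : ∀ t, 0 ≤ c t) (n : ℕ) (h : ReachLim F v c t p x y) (hpos : 0 < c (t + n)) :
    x - b / c (t + n) * y ≤ finSup F v n p := by
  have hb : 0 ≤ b := (hv0 p).trans (hv p)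
  induction n generalizing t p x y with
  | zero =>
    rw [add_zero] at hpos
    have h1 := h.le_cost hc
    have h2 := h.utility_le hv
    have h3 : b ≤ b / c t * y := by
      rw [div_mul_eq_mul_div, le_div_iff₀ hpos]
      exact mul_le_mul_of_nonneg_left h1 hb
    have := hv0 p
    simp only [finSup, add_zero]
    linarith
  | succ n ih =>
    have hy : 0 ≤ b / c (t + (n + 1)) * y :=
      mul_nonneg (div_nonneg hb hpos.le) ((hc0 t).trans (h.le_cost hc))
    rcases h.halt_or_step hF husc hv0 hv hc hc0 with
    h1 | ⟨e, he, hm, m, w, q, X, Y, hw, hexp, hXY, hX, hY⟩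
    · have h2 : v p ≤ finSup F v (n + 1) p :=
        monotone_nat_of_le_succ (f := fun n => finSup F v n p)
          (fun n => finSup_le_succ hT hv n p) (Nat.zero_le (n + 1))
      linarith
    · rw [← hm]
      refine le_trans ?_ (expect_finSup_le hT hv n he)
      rw [hexp, ← hX]
      have h2 : b / c (t + (n + 1)) * ∑ j, w j * Y j ≤ b / c (t + (n + 1)) * y :=
        mul_le_mul_of_nonneg_left hY (div_nonneg hb hpos.le)
      refine (sub_le_sub_left h2 _).trans ?_
      rw [Finset.mul_sum, ← Finset.sum_sub_distrib]
      refine Finset.sum_le_sum fun j _ => ?_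
      rcases (hw j).eq_or_lt with h0 | h0
      · simp [← h0]
      · have h3 := ih (hXY j h0) (by rwa [show t + 1 + n = t + (n + 1) by omega])
        rw [show t + 1 + n = t + (n + 1) by omega] at h3
        calc w j * X j - b / c (t + (n + 1)) * (w j * Y j)
            = w j * (X j - b / c (t + (n + 1)) * Y j) := by ring
          _ ≤ _ := mul_le_mul_of_nonneg_left h3 h0.le

lemma ReachLim.le_supVal (hT : trivialExperiments Ω ⊆ F) (hF : ClosedFeasible F)
    (husc : UpperSemicontinuous v) (hv0 : ∀ p, 0 ≤ v p) (hv : ∀ p, v p ≤ b) (hc : Monotone c)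
    (hc0 : ∀ t, 0 ≤ c t) (hct : Tendsto c atTop atTop) (h : ReachLim F v c t p x y) :
    x ≤ supVal F v p := by
  have hct' : Tendsto (fun n => c (t + n)) atTop atTop :=
    hct.comp (tendsto_atTop_mono (fun n => Nat.le_add_left n t) tendsto_id)
  have hlim := ((hct'.const_div_atTop b).mul_const y).const_sub x
  rw [zero_mul, sub_zero] at hlim
  refine le_of_tendsto hlim ?_
  filter_upwards [hct'.eventually_gt_atTop 0] with n hn
  exact (h.sub_le_finSup hT hF husc hv0 hv hc hc0 n hn).trans (finSup_le_supVal hT hv n p)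

/-- A limit triple with maximal utility, unless dominated by stopping, splits into limit triples with
maximal utility, one for each outcome of the experiment. -/
lemma ReachLim.exists_step (hT : trivialExperiments Ω ⊆ F) (hF : ClosedFeasible F)
    (husc : UpperSemicontinuous v) (hv0 : ∀ p, 0 ≤ v p) (hv : ∀ p, v p ≤ b) (hc : Monotone c)
    (hc0 : ∀ t, 0 ≤ c t) (hct : Tendsto c atTop atTop)
    (h : ReachLim F v c t p (supVal F v p) y) (hp : v p ≠ supVal F v p) :
    ∃ e ∈ F, e.mean = p ∧ e.expect (supVal F v) = supVal F v p ∧ ∃ Y : Belief Ω → ℝ,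
      (∀ q ∈ e.supp, ReachLim F v c (t + 1) q (supVal F v q) (Y q)) ∧ e.expect Y ≤ y := by
  classical
  rcases h.halt_or_step hF husc hv0 hv hc hc0 with
    h1 | ⟨e, he, hm, m, w, q, X, Y, hw, hexp, hXY, hX, hY⟩
  · exact absurd (le_antisymm (SeqPersuasion.le_supVal hT hv p) h1) hp
  have hUe : e.expect (supVal F v) ≤ supVal F v p := hm ▸ expect_supVal_le hT hv he
  have hle : ∀ j ∈ Finset.univ, w j * X j ≤ w j * supVal F v (q j) := by
    intro j _
    rcases (hw j).eq_or_lt with h0 | h0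
    · simp [← h0]
    · exact mul_le_mul_of_nonneg_left ((hXY j h0).le_supVal hT hF husc hv0 hv hc hc0 hct) h0.le
  have hEq : e.expect (supVal F v) = supVal F v p := by
    refine le_antisymm hUe ?_
    rw [hexp, ← hX]
    exact Finset.sum_le_sum hle
  have hXU : ∀ j, 0 < w j → X j = supVal F v (q j) := by
    intro j hj
    have := (Finset.sum_eq_sum_iff_of_le hle).1 (by rw [hX, ← hexp, hEq]) j (Finset.mem_univ j)
    exact mul_left_cancel₀ hj.ne' this
  -- Several slots may converge to the same belief `r`; the cheapest one of positive weight is kept.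
  have hmin : ∀ r, ∃ y', (∀ j, 0 < w j → q j = r → y' ≤ Y j) ∧
      (r ∈ e.supp → ReachLim F v c (t + 1) r (supVal F v r) y') := by
    intro r
    by_cases hr : (Finset.univ.filter fun j => 0 < w j ∧ q j = r).Nonempty
    · obtain ⟨j, hj, hjmin⟩ := Finset.exists_min_image _ Y hr
      obtain ⟨hj1, rfl⟩ := (Finset.mem_filter.1 hj).2
      refine ⟨Y j, fun i hi hi' => hjmin i (by simp [hi, hi']), fun _ => ?_⟩
      rw [← hXU j hj1]
      exact hXY j hj1
    · have hr' : ∀ j, 0 < w j → q j ≠ r := fun j hj hjr => hr ⟨j, by simp [hj, hjr]⟩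
      refine ⟨0, fun j hj hjr => absurd hjr (hr' j hj), fun hrs =>
        absurd ?_ (Experiment.weights_pos hrs).ne'⟩
      have h2 : e.expect (fun s => if s = r then 1 else 0) = e.weights r := by
        simp [Experiment.expect, hrs]
      rw [← h2, hexp]
      refine Finset.sum_eq_zero fun j _ => ?_
      rcases (hw j).eq_or_lt with h0 | h0
      · simp [← h0]
      · simp [hr' j h0]
  choose Y' hY'1 hY'2 using hmin
  refine ⟨e, he, hm, hEq, Y', hY'2, le_trans ?_ hY⟩
  rw [hexp]
  refine Finset.sum_le_sum fun j _ => ?_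
  rcases (hw j).eq_or_lt with h0 | h0
  · simp [← h0]
  · exact mul_le_mul_of_nonneg_left (hY'1 _ j h0 rfl) h0.le

end Reach

section Existence

variable {F : Set (Experiment Ω)} {v : Belief Ω → ℝ} {c : ℕ → ℝ} {b : ℝ}
  {μ : Belief Ω}

/-! ### Rules with memory -/

/-- The value of a real memory cell, updated in each step, after a history. -/
def memory (nxt : ℕ → Belief Ω → ℝ → Belief Ω → ℝ) (y₀ : ℝ) : {n : ℕ} → History Ω n → ℝ
  | _, .start _ => y₀
  | _, .step (n := n) ξ _ q => nxt n ξ.last (memory nxt y₀ ξ) q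

open Classical in
/-- A limit triple at time zero with maximal utility yields an optimal infinite persuasion. -/
lemma ReachLim.exists_isOptimal (hT : trivialExperiments Ω ⊆ F) (hF : ClosedFeasible F)
    (husc : UpperSemicontinuous v) (hv0 : ∀ p, 0 ≤ v p) (hv : ∀ p, v p ≤ b) (hc : Monotone c)
    (hc0 : ∀ t, 0 ≤ c t) (hct : Tendsto c atTop atTop) {y₀ : ℝ}
    (h : ReachLim F v c 0 μ (supVal F v μ) y₀) : ∃ φ : Rule Ω, IsOptimal F v μ φ := by
  -- The properties are made conditional so that the choices are total functions of time, belief and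
  -- memory.
  have hex : ∀ (t : ℕ) (p : Belief Ω) (y : ℝ), ∃ (e : Experiment Ω) (Y : Belief Ω → ℝ),
      ReachLim F v c t p (supVal F v p) y → v p ≠ supVal F v p →
      e ∈ F ∧ e.mean = p ∧ e.expect (supVal F v) = supVal F v p ∧
      (∀ q ∈ e.supp, ReachLim F v c (t + 1) q (supVal F v q) (Y q)) ∧ e.expect Y ≤ y := by
    intro t p y
    by_cases h : ReachLim F v c t p (supVal F v p) y ∧ v p ≠ supVal F v p
    · obtain ⟨e, h1, h2, h3, Y, h4, h5⟩ := h.1.exists_step hT hF husc hv0 hv hc hc0 hct h.2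
      exact ⟨e, Y, fun _ _ => ⟨h1, h2, h3, h4, h5⟩⟩
    · exact ⟨Experiment.triv p, 0, fun h1 h2 => absurd ⟨h1, h2⟩ h⟩
  choose act nxt hact using hex
  let mem : {n : ℕ} → History Ω n → ℝ := memory nxt y₀
  let φ : Rule Ω := fun i ξ =>
    if v ξ.last = supVal F v ξ.last then Experiment.triv ξ.last else act i ξ.last (mem ξ)
  have hinv : ∀ i, ∀ ξ ∈ φ.histories μ i, v ξ.last = supVal F v ξ.last ∨
      ReachLim F v c i ξ.last (supVal F v ξ.last) (mem ξ) := by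
    refine Rule.histories_induction (P := fun i ξ => v ξ.last = supVal F v ξ.last ∨
      ReachLim F v c i ξ.last (supVal F v ξ.last) (mem ξ)) (Or.inr h) ?_
    intro i ξ _ ih p hp
    by_cases hs : v ξ.last = supVal F v ξ.last
    · left
      simp only [φ, hs, if_true, Experiment.supp_triv, Finset.mem_singleton] at hp
      simpa [History.last, hp] using hs
    · right
      simp only [φ, hs, if_false] at hp
      exact (hact i _ _ (ih.resolve_left hs) hs).2.2.2.1 p hp
  have hφ : φ.IsPersuasion F μ ⊤ := by
    intro i _ ξ hξ
    by_cases hs : v ξ.last = supVal F v ξ.last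
    · simp only [φ, hs, if_true]
      exact ⟨Experiment.triv_mem hT _, Experiment.mean_triv _⟩
    · simp only [φ, hs, if_false]
      have := hact i _ _ ((hinv i ξ hξ).resolve_left hs) hs
      exact ⟨this.1, this.2.1⟩
  -- The stored cost of unfinished histories is a nonnegative supermartingale, and it is at least `c
  -- n` at time `n`; this gives Markov's inequality below.
  have hcost : ∀ n, (φ.histSum μ n fun ξ =>
      if v ξ.last = supVal F v ξ.last then 0 else mem ξ) ≤ y₀ := by
    intro n
    have hy₀ : 0 ≤ y₀ := (hc0 0).trans (h.le_cost hc)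
    induction n with
    | zero =>
      rw [Rule.histSum_zero]
      split_ifs
      exacts [hy₀, le_rfl]
    | succ n ih =>
      refine le_trans ?_ ih
      rw [Rule.histSum_succ]
      refine Rule.histSum_mono fun ξ hξ => ?_
      by_cases hs : v ξ.last = supVal F v ξ.last
      · have hφξ : φ n ξ = Experiment.triv ξ.last := by simp [φ, hs]
        rw [hφξ, Experiment.expect_triv]
        exact ((if_pos hs).trans (if_pos hs).symm).le
      · simp only [φ, hs, if_false]
        have := hact n _ _ ((hinv n ξ hξ).resolve_left hs) hs
        refine le_trans (Experiment.expect_mono fun q hq => ?_) this.2.2.2.2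
        split_ifs
        · exact (hc0 _).trans ((this.2.2.2.1 q hq).le_cost hc)
        · exact le_rfl
  refine ⟨φ, hφ, le_antisymm ?_ ?_⟩
  · rw [vInf_eq_supVal hT hv0 hv]
    exact Rule.infValue_le_supVal hT hv0 hv hφ
  · rw [vInf_eq_supVal hT hv0 hv]
    refine Rule.le_infValue hv0 hv (T := fun _ p => v p = supVal F v p) (fun _ => supVal F v)
      (fun _ p => supVal_le hT hv p) (fun i ξ hξ => ?_) (fun i ξ hs => ⟨?_, hs.ge⟩) ?_
    · by_cases hs : v ξ.last = supVal F v ξ.last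
      · simp only [φ, hs, if_true, Experiment.expect_triv]
        exact le_rfl
      · simp only [φ, hs, if_false]
        exact (hact i _ _ ((hinv i ξ hξ).resolve_left hs) hs).2.2.1.ge
    · exact Rule.terminatesAfter_of_invariant (T := fun _ p => v p = supVal F v p)
        (fun _ _ h => h) (fun i ξ h => by simp [φ, h]) hs
    · refine squeeze_zero' (Eventually.of_forall fun n => Rule.histSum_nonneg fun ξ _ => ?_) ?_
        (hct.const_div_atTop y₀)
      · split_ifs <;> simp
      · filter_upwards [hct.eventually_gt_atTop 0] with n hn
        rw [le_div_iff₀ hn, mul_comm, ← Rule.histSum_const_mul]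
        refine (Rule.histSum_mono fun ξ hξ => ?_).trans (hcost n)
        by_cases hs : v ξ.last = supVal F v ξ.last
        · simp [hs]
        · simpa [hs] using ((hinv n ξ hξ).resolve_left hs).le_cost hc

/-! ### From uniform termination to an optimal persuasion -/

open Classical in
/-- A finite persuasion attains its expected utility at the cost given by its termination time. -/
lemma Rule.IsPersuasion.reach {φ : Rule Ω} {n : ℕ} (hφ : φ.IsPersuasion F μ n) (c : ℕ → ℝ) :
    Reach F v c 0 μ (φ.finValue v μ n)
      (c 0 + ∑ s ∈ Finset.range n, (c (s + 1) - c s) * φ.probActive μ n s) := by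
  have key : ∀ l i, i + l = n → ∃ X Y : History Ω i → ℝ,
      (∀ ξ ∈ φ.histories μ i, Reach F v c i ξ.last (X ξ) (Y ξ)) ∧
      (∀ ξ, φ.TerminatesAfter n ξ → X ξ = v ξ.last ∧ Y ξ = c i) ∧
      φ.histSum μ i X = φ.finValue v μ n ∧
      φ.histSum μ i Y =
        c i + ∑ s ∈ Finset.Ico i n, (c (s + 1) - c s) * φ.probActive μ n s := by
    intro l
    induction l with
    | zero =>
      rintro i rfl
      refine ⟨fun ξ => v ξ.last, fun _ => c i, fun ξ _ => Reach.halt _ _, fun ξ _ => ⟨rfl, rfl⟩,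
        rfl, ?_⟩
      simp
    | succ l ih =>
      intro i hi
      have hin : (i : ℕ∞) < n := by exact_mod_cast (by omega : i < n)
      obtain ⟨X, Y, hr, ht, hX, hY⟩ := ih (i + 1) (by omega)
      have hcond : ∀ ξ, φ.TerminatesAfter n ξ →
          (φ i ξ).expect (fun p => X (ξ.step (φ i ξ) p)) = v ξ.last ∧
          (φ i ξ).expect (fun p => Y (ξ.step (φ i ξ) p)) = c (i + 1) := by
        intro ξ h
        rw [h.eq_triv hin, Experiment.expect_triv, Experiment.expect_triv]
        exact ht _ h.step
      refine ⟨fun ξ => if φ.TerminatesAfter n ξ then v ξ.last else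
          (φ i ξ).expect fun p => X (ξ.step (φ i ξ) p),
        fun ξ => if φ.TerminatesAfter n ξ then c i else
          (φ i ξ).expect fun p => Y (ξ.step (φ i ξ) p), fun ξ hξ => ?_, fun ξ h => by simp [h],
        ?_, ?_⟩
      · dsimp only
        split_ifs with h
        · exact Reach.halt _ _
        · obtain ⟨hF, hm⟩ := hφ i hin ξ hξ
          have := Reach.step (v := v) (c := c) i (φ i ξ) hF (fun p => X (ξ.step (φ i ξ) p))
            (fun p => Y (ξ.step (φ i ξ) p)) fun q hq => hr _ (Rule.step_mem hξ hq)
          rwa [hm] at this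
      · rw [← hX, Rule.histSum_succ]
        refine Rule.histSum_congr fun ξ _ => ?_
        split_ifs with h
        exacts [(hcond ξ h).1.symm, rfl]
      -- Stopping at `i` instead of `i + 1` saves `c (i + 1) - c i` on terminated histories only:
      -- summation by parts.
      · have h1 : φ.histSum μ i (fun ξ => if φ.TerminatesAfter n ξ then c i else
            (φ i ξ).expect fun p => Y (ξ.step (φ i ξ) p)) =
            φ.histSum μ (i + 1) Y + φ.histSum μ i (fun ξ => (c i - c (i + 1)) +
              (c (i + 1) - c i) * if φ.TerminatesAfter n ξ then 0 else 1) := by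
          rw [Rule.histSum_succ, ← Rule.histSum_add]
          refine Rule.histSum_congr fun ξ _ => ?_
          split_ifs with h
          · rw [(hcond ξ h).2]; ring
          · ring
        rw [h1, hY, Rule.histSum_add, Rule.histSum_const, Rule.histSum_const_mul,
          Finset.sum_eq_sum_Ico_succ_bot (show i < n by omega)]
        unfold Rule.probActive
        ring
  obtain ⟨X, Y, hr, -, hX, hY⟩ := key n 0 (by omega)
  rw [Rule.histSum_zero] at hX hY
  rw [← hX, Finset.range_eq_Ico, ← hY]
  exact hr (History.start μ) (by simp [Rule.histories])

/-- The cost `c t` counts the times `m j` below `t`. As the probability of being active at `m j` is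
at most `2⁻ʲ`, all expected costs are at most 2, and a subsequence of them converges. -/
theorem UniformTermination.exists_isOptimal (hT : trivialExperiments Ω ⊆ F)
    (hF : ClosedFeasible F) (husc : UpperSemicontinuous v) (hv0 : ∀ p, 0 ≤ v p)
    (hv : ∀ p, v p ≤ b) (h : UniformTermination F v μ) : ∃ φ : Rule Ω, IsOptimal F v μ φ := by
  classical
  obtain ⟨n, S, hS, hlim, hunif⟩ := h
  choose m₀ hm₀ using fun j : ℕ => hunif ((1 / 2) ^ j) (by positivity)
  -- Partial sums make the termination times strictly increasing while still at least `m₀ j`.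
  let m : ℕ → ℕ := fun j => ∑ i ∈ Finset.range (j + 1), (m₀ i + 1)
  have hm : StrictMono m := strictMono_nat_of_lt_succ fun j => by
    simp only [m]; rw [Finset.sum_range_succ _ (j + 1)]; omega
  have hm₀m : ∀ j, m₀ j ≤ m j := fun j => by
    simp only [m]; rw [Finset.sum_range_succ]; omega
  have hact : ∀ j k, m j ≤ n k → (S k).probActive μ (n k) (m j) ≤ (1 / 2) ^ j := by
    intro j k hjk
    have h1 := hm₀ j k ((hm₀m j).trans hjk)
    rw [Rule.probTerminates_eq] at h1
    have h2 := Rule.probActive_le_of_le (φ := S k) (μ := μ) (hm₀m j) (N := n k)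
      (by exact_mod_cast hjk)
    linarith
  let d : ℕ → ℝ := fun s => if s ∈ Set.range m then 1 else 0
  have hd : ∀ s, 0 ≤ d s := fun s => by simp only [d]; split_ifs <;> simp
  let c : ℕ → ℝ := fun t => ∑ s ∈ Finset.range t, d s
  have hcs : ∀ t, c (t + 1) - c t = d t := fun t => by
    simp only [c, Finset.sum_range_succ]; ring
  have hc : Monotone c := monotone_nat_of_le_succ fun t => by linarith [hcs t, hd t]
  have hc0 : ∀ t, 0 ≤ c t := fun t => Finset.sum_nonneg fun s _ => hd s
  have hct : Tendsto c atTop atTop := by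
    refine tendsto_atTop_atTop_of_monotone hc fun B => ?_
    obtain ⟨J, hJ⟩ := exists_nat_ge B
    refine ⟨m J, hJ.trans ?_⟩
    have hsub : (Finset.range J).image m ⊆ Finset.range (m J) := by
      intro s hs
      obtain ⟨j, hj, rfl⟩ := Finset.mem_image.1 hs
      exact Finset.mem_range.2 (hm (Finset.mem_range.1 hj))
    refine le_trans ?_ (Finset.sum_le_sum_of_subset_of_nonneg hsub fun s _ _ => hd s)
    rw [Finset.sum_image fun i _ j _ hij => hm.injective hij]
    simp [d]
  have hcost : ∀ k, ∑ s ∈ Finset.range (n k), (c (s + 1) - c s) * (S k).probActive μ (n k) s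
      ≤ 2 := by
    intro k
    have h1 : ∀ s ∈ Finset.range (n k), (c (s + 1) - c s) * (S k).probActive μ (n k) s =
        if s ∈ Set.range m then (S k).probActive μ (n k) s else 0 := fun s _ => by
      rw [hcs]; simp only [d]; split_ifs <;> simp
    rw [Finset.sum_congr rfl h1, ← Finset.sum_filter]
    have h2 : (Finset.range (n k)).filter (· ∈ Set.range m) ⊆
        ((Finset.range (n k)).filter (m · < n k)).image m := by
      intro s hs
      obtain ⟨hs1, j, rfl⟩ := Finset.mem_filter.1 hs
      have := Finset.mem_range.1 hs1
      exact Finset.mem_image.2 ⟨j, by simp [this, (hm.le_apply).trans_lt this], rfl⟩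
    refine (Finset.sum_le_sum_of_subset_of_nonneg h2
      fun s _ _ => Rule.probActive_nonneg _ _ _ _).trans ?_
    rw [Finset.sum_image fun i _ j _ hij => hm.injective hij]
    refine le_trans (Finset.sum_le_sum fun j hj => hact j k (Finset.mem_filter.1 hj).2.le) ?_
    refine le_trans (Finset.sum_le_sum_of_subset_of_nonneg (Finset.filter_subset _ _)
      fun j _ _ => by positivity) ?_
    exact sum_geometric_two_le _
  have hc00 : c 0 = 0 := by simp [c]
  obtain ⟨y, -, σ, hσ, hy⟩ := (isCompact_Icc (a := (0 : ℝ)) (b := 2)).tendsto_subseq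
    (x := fun k => c 0 + ∑ s ∈ Finset.range (n k),
      (c (s + 1) - c s) * (S k).probActive μ (n k) s)
    (fun k => ⟨by
      rw [hc00, zero_add]
      exact Finset.sum_nonneg fun s _ =>
        mul_nonneg (by rw [hcs]; exact hd s) (Rule.probActive_nonneg _ _ _ _), by
      rw [hc00, zero_add]; exact hcost k⟩)
  rw [vInf_eq_supVal hT hv0 hv] at hlim
  exact ReachLim.exists_isOptimal hT hF husc hv0 hv hc hc0 hct
    ⟨fun _ => μ, _, _, fun k => (hS (σ k)).reach c, tendsto_const_nhds,
      hlim.comp hσ.tendsto_atTop, hy⟩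

end Existence

/-! ### Certificates for reaching a set under a stationary strategy -/

section Certificate

variable {Act : Belief Ω → Experiment Ω → Prop} {Z : Set (Belief Ω)} {K : Finset (Belief Ω)}
  {ρ : Belief Ω → Experiment Ω} {u u₁ u₂ : Belief Ω → ℝ}

/-- `u` bounds from below the probability of reaching `Z` when `ρ` is used on `K` and the process is
killed outside `K ∪ Z`. -/
structure IsCert (Act : Belief Ω → Experiment Ω → Prop) (Z : Set (Belief Ω))
    (K : Finset (Belief Ω)) (ρ : Belief Ω → Experiment Ω) (u : Belief Ω → ℝ) : Prop where
  act : ∀ p ∈ K, Act p (ρ p)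
  nonneg : ∀ p, 0 ≤ u p
  le_one : ∀ p, u p ≤ 1
  eq_zero : ∀ p, p ∉ K → p ∉ Z → u p = 0
  le_expect : ∀ p ∈ K, u p ≤ (ρ p).expect u

/-- `u` is a certificate for some extension of the strategy `ρ` on `K`. -/
def ExtCert (Act : Belief Ω → Experiment Ω → Prop) (Z : Set (Belief Ω))
    (K : Finset (Belief Ω)) (ρ : Belief Ω → Experiment Ω) (u : Belief Ω → ℝ) : Prop :=
  ∃ K' ρ', K ⊆ K' ∧ (∀ p ∈ K, ρ' p = ρ p) ∧ IsCert Act Z K' ρ' u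

/-- At each belief the strategy with the larger certificate is used. Where a strategy is undefined
outside `Z` its certificate is zero, so the other one can be taken. -/
lemma ExtCert.sup (hZ : ∀ p e, Act p e → p ∉ Z) (h₁ : ExtCert Act Z K ρ u₁)
    (h₂ : ExtCert Act Z K ρ u₂) : ExtCert Act Z K ρ fun p => max (u₁ p) (u₂ p) := by
  classical
  obtain ⟨K₁, ρ₁, hK₁, hρ₁, c₁⟩ := h₁
  obtain ⟨K₂, ρ₂, hK₂, hρ₂, c₂⟩ := h₂
  refine ⟨K₁ ∪ K₂, fun p => if p ∈ K₁ ∧ (u₂ p ≤ u₁ p ∨ p ∉ K₂) then ρ₁ p else ρ₂ p,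
    hK₁.trans Finset.subset_union_left, fun p hp => ?_, fun p hp => ?_,
    fun p => (c₁.nonneg p).trans (le_max_left _ _),
    fun p => max_le (c₁.le_one p) (c₂.le_one p), fun p hp hpZ => ?_, fun p hp => ?_⟩
  · dsimp only
    split_ifs
    exacts [hρ₁ p hp, hρ₂ p hp]
  · split_ifs with h
    · exact c₁.act p h.1
    · refine c₂.act p ?_
      by_contra hp2
      exact h ⟨(Finset.mem_union.1 hp).resolve_right hp2, Or.inr hp2⟩
  · rw [Finset.mem_union, not_or] at hp
    rw [c₁.eq_zero p hp.1 hpZ, c₂.eq_zero p hp.2 hpZ, max_self]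
  · split_ifs with h
    · have hle : u₂ p ≤ u₁ p := by
        rcases h.2 with h2 | h2
        · exact h2
        · rw [c₂.eq_zero p h2 (hZ p _ (c₁.act p h.1))]; exact c₁.nonneg p
      rw [max_eq_left hle]
      exact (c₁.le_expect p h.1).trans (Experiment.expect_mono fun _ _ => le_max_left _ _)
    · have hp2 : p ∈ K₂ := by
        by_contra hp2
        exact h ⟨(Finset.mem_union.1 hp).resolve_right hp2, Or.inr hp2⟩
      have hle : u₁ p ≤ u₂ p := by
        by_cases hp1 : p ∈ K₁
        · by_contra hlt
          exact h ⟨hp1, Or.inl (not_le.1 hlt).le⟩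
        · rw [c₁.eq_zero p hp1 (hZ p _ (c₂.act p hp2))]; exact c₂.nonneg p
      rw [max_eq_right hle]
      exact (c₂.le_expect p hp2).trans (Experiment.expect_mono fun _ _ => le_max_right _ _)

/-- If `e` promises more than `u p`, play `e` at `p` and raise `u` there; raising `u` preserves the
inequalities elsewhere. -/
lemma ExtCert.exists_improvement (h : ExtCert Act Z K ρ u) {p : Belief Ω} {e : Experiment Ω}
    (he : Act p e) (hp : p ∈ K → e = ρ p) :
    ∃ u', ExtCert Act Z K ρ u' ∧ e.expect u ≤ u' p := by
  classical
  obtain ⟨K', ρ', hK, hρ, c⟩ := h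
  rcases le_total (e.expect u) (u p) with hle | hle
  · exact ⟨u, ⟨K', ρ', hK, hρ, c⟩, hle⟩
  have hu : ∀ q, u q ≤ Function.update u p (e.expect u) q := by
    intro q
    by_cases hq : q = p
    · subst hq; simpa using hle
    · simp [hq]
  refine ⟨Function.update u p (e.expect u), ⟨insert p K', Function.update ρ' p e,
    hK.trans (Finset.subset_insert _ _), fun q hq => ?_, fun q hq => ?_,
    fun q => (c.nonneg q).trans (hu q), fun q => ?_, fun q hq hqZ => ?_, fun q hq => ?_⟩, by simp⟩
  · by_cases hqp : q = p
    · subst hqp; simpa using hp hq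
    · simpa [hqp] using hρ q hq
  · by_cases hqp : q = p
    · subst hqp; simpa using he
    · simpa [hqp] using c.act q ((Finset.mem_insert.1 hq).resolve_left hqp)
  · by_cases hqp : q = p
    · subst hqp; simpa using Experiment.expect_le_const fun q _ => c.le_one q
    · simpa [hqp] using c.le_one q
  · rw [Finset.mem_insert, not_or] at hq
    simpa [hq.1] using c.eq_zero q hq.2 hqZ
  · by_cases hqp : q = p
    · subst hqp
      simpa using Experiment.expect_mono fun q _ => hu q
    · simpa [hqp] using (c.le_expect q ((Finset.mem_insert.1 hq).resolve_left hqp)).trans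
        (Experiment.expect_mono fun q _ => hu q)

open Classical in
lemma extCert_indicator (hZ : ∀ p e, Act p e → p ∉ Z) (hK : ∀ p ∈ K, Act p (ρ p)) :
    ExtCert Act Z K ρ fun p => if p ∈ Z then 1 else 0 := by
  refine ⟨K, ρ, subset_rfl, fun _ _ => rfl, hK, fun p => ?_, fun p => ?_, fun p _ hp => if_neg hp,
    fun p hp => ?_⟩
  · split_ifs <;> simp
  · split_ifs <;> simp
  · rw [if_neg (hZ p _ (hK p hp))]
    exact Experiment.const_le_expect fun q _ => by split_ifs <;> simp

/-- The supremum of the certificates for extensions of `ρ` on `K`. -/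
def certSup (Act : Belief Ω → Experiment Ω → Prop) (Z : Set (Belief Ω))
    (K : Finset (Belief Ω)) (ρ : Belief Ω → Experiment Ω) (p : Belief Ω) : ℝ :=
  sSup {x | ∃ u, ExtCert Act Z K ρ u ∧ u p = x}

lemma ExtCert.le_certSup (h : ExtCert Act Z K ρ u) (p : Belief Ω) : u p ≤ certSup Act Z K ρ p := by
  refine le_csSup ⟨1, ?_⟩ ⟨u, h, rfl⟩
  rintro _ ⟨u, ⟨_, _, _, _, c⟩, rfl⟩
  exact c.le_one p

lemma certSup_le_one (hZ : ∀ p e, Act p e → p ∉ Z) (hK : ∀ p ∈ K, Act p (ρ p)) (p : Belief Ω) :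
    certSup Act Z K ρ p ≤ 1 := by
  refine csSup_le ⟨_, _, extCert_indicator hZ hK, rfl⟩ ?_
  rintro _ ⟨u, ⟨_, _, _, _, c⟩, rfl⟩
  exact c.le_one p

lemma certSup_nonneg (hZ : ∀ p e, Act p e → p ∉ Z) (hK : ∀ p ∈ K, Act p (ρ p)) (p : Belief Ω) :
    0 ≤ certSup Act Z K ρ p := by
  classical
  refine le_trans ?_ ((extCert_indicator hZ hK).le_certSup p)
  split_ifs <;> simp

lemma certSup_eq_one (hZ : ∀ p e, Act p e → p ∉ Z) (hK : ∀ p ∈ K, Act p (ρ p)) {p : Belief Ω}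
    (hp : p ∈ Z) : certSup Act Z K ρ p = 1 := by
  classical
  refine le_antisymm (certSup_le_one hZ hK p) ?_
  simpa [hp] using (extCert_indicator hZ hK).le_certSup p

lemma exists_extCert_near (hZ : ∀ p e, Act p e → p ∉ Z) (hK : ∀ p ∈ K, Act p (ρ p)) {ε : ℝ}
    (hε : 0 < ε) (S : Finset (Belief Ω)) :
    ∃ u, ExtCert Act Z K ρ u ∧ ∀ p ∈ S, certSup Act Z K ρ p - ε ≤ u p := by
  classical
  induction S using Finset.induction_on with
  | empty => exact ⟨_, extCert_indicator hZ hK, by simp⟩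
  | insert p S _ ih =>
    obtain ⟨u, hu, huS⟩ := ih
    obtain ⟨_, ⟨u', hu', rfl⟩, hlt⟩ := exists_lt_of_lt_csSup
      (s := {x | ∃ u, ExtCert Act Z K ρ u ∧ u p = x}) ⟨_, _, hu, rfl⟩
      (sub_lt_self (certSup Act Z K ρ p) hε)
    refine ⟨_, hu.sup hZ hu', fun q hq => ?_⟩
    rcases Finset.mem_insert.1 hq with rfl | hq
    · exact hlt.le.trans (le_max_right _ _)
    · exact (huS q hq).trans (le_max_left _ _)

/-- One certificate is nearly optimal at all outcomes of `e` at once; prepending `e` at `p` then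
gives a certificate for `p`. -/
lemma expect_certSup_le (hZ : ∀ p e, Act p e → p ∉ Z) (hK : ∀ p ∈ K, Act p (ρ p))
    {p : Belief Ω} {e : Experiment Ω} (he : Act p e) (hp : p ∈ K → e = ρ p) :
    e.expect (certSup Act Z K ρ) ≤ certSup Act Z K ρ p := by
  refine le_of_forall_pos_le_add fun ε hε => ?_
  obtain ⟨u, hu, huS⟩ := exists_extCert_near hZ hK hε e.supp
  obtain ⟨u', hu', hle⟩ := hu.exists_improvement he hp
  have h1 := Experiment.expect_mono huS
  rw [Experiment.expect_sub, Experiment.expect_const] at h1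
  linarith [hu'.le_certSup p]

lemma sqNorm_lt_expect_of_nontrivial {e : Experiment Ω} {p : Belief Ω} (hm : e.mean = p)
    (he : e ∉ trivialExperiments Ω) : sqNorm p < e.expect sqNorm := by
  rw [← hm]
  exact sqNorm_lt_expect (Experiment.ne_triv_of_notMem he _)

/-- If the beliefs in `R` satisfy the maximum principle relative to finite sets, then every strategy
on a finite set has extensions that reach `Z` with probability close to one. -/
lemma certSup_eq_one_of_maximum_principle (hZ : ∀ p e, Act p e → p ∉ Z)
    (hK : ∀ p ∈ K, Act p (ρ p)) {R : Set (Belief Ω)}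
    (hAct : ∀ p e, Act p e → p ∈ R ∧ e.mean = p ∧ e ∉ trivialExperiments Ω ∧ ∀ q ∈ e.supp, q ∈ R)
    (hmax : ∀ (G : Belief Ω → ℝ) (C M : ℝ), (∀ p, G p ≤ C) → (∀ p ∈ K, G p ≤ M) →
      (∀ p ∈ Z, G p ≤ M) → (∀ p ∉ K, ∀ e, Act p e → G p ≤ e.expect G) → ∀ p ∈ R, G p ≤ M)
    {p : Belief Ω} (hp : p ∈ R) : certSup Act Z K ρ p = 1 := by
  have hU1 := certSup_le_one hZ hK
  have hU0 := certSup_nonneg hZ hK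
  refine le_antisymm (hU1 p) (le_of_forall_pos_le_add fun η hη => ?_)
  let G : Belief Ω → ℝ := fun p => (1 - certSup Act Z K ρ p) + η * sqNorm p
  have hGexp : ∀ e : Experiment Ω, e.expect G =
      1 - e.expect (certSup Act Z K ρ) + η * e.expect sqNorm := fun e => by
    simp only [G]
    rw [Experiment.expect_add, Experiment.expect_sub, Experiment.expect_const,
      Experiment.expect_const_mul]
  have hGstep : ∀ p e, Act p e → (p ∈ K → e = ρ p) → G p < e.expect G := by
    intro p e he hpK
    rw [hGexp]
    have h1 := expect_certSup_le hZ hK he hpK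
    have h2 := mul_lt_mul_of_pos_left
      (sqNorm_lt_expect_of_nontrivial (hAct p e he).2.1 (hAct p e he).2.2.1) hη
    simp only [G]
    linarith
  have hGC : ∀ p, G p ≤ 1 + η := fun p => by
    have := mul_le_mul_of_nonneg_left (sqNorm_le_one p) hη.le
    simp only [G]
    linarith [hU0 p]
  have hGZ : ∀ p ∈ Z, G p ≤ η := fun p hp => by
    have := mul_le_mul_of_nonneg_left (sqNorm_le_one p) hη.le
    simp only [G]
    rw [certSup_eq_one hZ hK hp]
    linarith
  have hmax' : ∀ M, η ≤ M → (∀ p ∈ K, G p ≤ M) → ∀ p ∈ R, G p ≤ M := fun M hM hKM =>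
    hmax G (1 + η) M hGC hKM (fun p hp => (hGZ p hp).trans hM)
      fun p hpK e he => (hGstep p e he fun h => absurd h hpK).le
  -- A maximum of `G` over `K` above `η` would bound `G` on all of `R`, contradicting the strict
  -- increase of its expectation under `ρ`.
  have hKη : ∀ p ∈ K, G p ≤ η := by
    by_contra! hcon
    obtain ⟨p₁, hp₁, hlt⟩ := hcon
    obtain ⟨p₀, hp₀, hp₀max⟩ := Finset.exists_max_image K G ⟨p₁, hp₁⟩
    have hle := hmax' (G p₀) (hlt.le.trans (hp₀max p₁ hp₁)) hp₀max
    have h1 := hGstep p₀ _ (hK p₀ hp₀) fun _ => rfl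
    exact absurd (Experiment.expect_le_const fun q hq =>
      hle q ((hAct _ _ (hK p₀ hp₀)).2.2.2 q hq)) (not_le.2 h1)
  have h1 := hmax' η le_rfl hKη p hp
  have h2 := mul_nonneg hη.le (sqNorm_nonneg p)
  simp only [G] at h1
  linarith

/-- A stationary strategy that has, for every `ε`, a certificate with value above `1 - ε` at `μ`. -/
lemma exists_strategy_of_certSup {μ : Belief Ω} {ρ₀ : Belief Ω → Experiment Ω}
    (hZ : ∀ p e, Act p e → p ∉ Z)
    (h : ∀ (K : Finset (Belief Ω)) (ρ : Belief Ω → Experiment Ω), (∀ p ∈ K, Act p (ρ p)) →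
      certSup Act Z K ρ μ = 1) {D : Set (Belief Ω)} (hρ₀ : ∀ p ∈ D, Act p (ρ₀ p)) :
    ∃ ρ : Belief Ω → Experiment Ω, (∀ p ∈ D, Act p (ρ p)) ∧
      ∀ ε > 0, ∃ K u, IsCert Act Z K ρ u ∧ 1 - ε ≤ u μ := by
  classical
  let P := {x : Finset (Belief Ω) × (Belief Ω → Experiment Ω) // ∀ p ∈ x.1, Act p (x.2 p)}
  have hext : ∀ (n : ℕ) (x : P), ∃ (y : P) (u : Belief Ω → ℝ), x.1.1 ⊆ y.1.1 ∧
      (∀ p ∈ x.1.1, y.1.2 p = x.1.2 p) ∧ IsCert Act Z y.1.1 y.1.2 u ∧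
      1 - 1 / ((n : ℝ) + 1) ≤ u μ := by
    intro n x
    obtain ⟨u, ⟨K', ρ', h1, h2, h3⟩, hu⟩ :=
      exists_extCert_near hZ x.2 (Nat.one_div_pos_of_nat (α := ℝ) (n := n)) {μ}
    refine ⟨⟨(K', ρ'), h3.act⟩, u, h1, h2, h3, ?_⟩
    simpa [h _ _ x.2] using hu μ (by simp)
  choose nxt w hsub hagree hcert hw using hext
  -- Each stage extends the previous finite strategy without changing it, so the union is well
  -- defined.
  let s : ℕ → P := fun n => Nat.rec ⟨(∅, ρ₀), by simp⟩ (fun n x => nxt n x) n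
  have hmono : Monotone fun n => (s n).1.1 := monotone_nat_of_le_succ fun n => hsub n (s n)
  have hag : ∀ {m n : ℕ}, m ≤ n → ∀ p ∈ (s m).1.1, (s n).1.2 p = (s m).1.2 p := by
    intro m n hmn p hp
    induction n, hmn using Nat.le_induction with
    | base => rfl
    | succ n hmn ih => exact (hagree n (s n) p (hmono hmn hp)).trans ih
  let ρ : Belief Ω → Experiment Ω := fun p =>
    if hp : ∃ n, p ∈ (s n).1.1 then (s hp.choose).1.2 p else ρ₀ p
  have hρ : ∀ n, ∀ p ∈ (s n).1.1, ρ p = (s n).1.2 p := by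
    intro n p hp
    have hex : ∃ n, p ∈ (s n).1.1 := ⟨n, hp⟩
    simp only [ρ, dif_pos hex]
    rcases le_total n hex.choose with hle | hle
    · exact hag hle p hp
    · exact (hag hle p hex.choose_spec).symm
  refine ⟨ρ, fun p hp => ?_, fun ε hε => ?_⟩
  · by_cases hex : ∃ n, p ∈ (s n).1.1
    · obtain ⟨n, hn⟩ := hex
      rw [hρ n p hn]
      exact (s n).2 p hn
    · simp only [ρ, dif_neg hex]
      exact hρ₀ p hp
  · obtain ⟨n, hn⟩ := exists_nat_one_div_lt hε
    have hc := hcert n (s n)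
    -- A certificate involves the strategy only on its finite set, where the union agrees with stage
    -- `n + 1`.
    have hρ' : ∀ p ∈ (nxt n (s n)).1.1, ρ p = (nxt n (s n)).1.2 p := hρ (n + 1)
    refine ⟨(nxt n (s n)).1.1, w n (s n), ⟨fun p hp => ?_, hc.nonneg, hc.le_one, hc.eq_zero,
      fun p hp => ?_⟩, by linarith [hw n (s n)]⟩
    · rw [hρ' p hp]; exact hc.act p hp
    · rw [hρ' p hp]; exact hc.le_expect p hp

open Classical in
/-- The probability that the stationary strategy does not reach `Z` within `n` steps. -/
def missProb (Z : Set (Belief Ω)) (ρ : Belief Ω → Experiment Ω) : ℕ → Belief Ω → ℝ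
  | 0 => fun p => if p ∈ Z then 0 else 1
  | n + 1 => fun p => if p ∈ Z then 0 else (ρ p).expect (missProb Z ρ n)

lemma missProb_of_mem {p : Belief Ω} (hp : p ∈ Z) (n : ℕ) : missProb Z ρ n p = 0 := by
  cases n <;> simp [missProb, hp]

lemma missProb_succ {p : Belief Ω} (hp : p ∉ Z) (n : ℕ) :
    missProb Z ρ (n + 1) p = (ρ p).expect (missProb Z ρ n) := if_neg hp

lemma missProb_nonneg (n : ℕ) (p : Belief Ω) : 0 ≤ missProb Z ρ n p := by
  induction n generalizing p with
  | zero => simp only [missProb]; split_ifs <;> simp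
  | succ n ih =>
    simp only [missProb]; split_ifs
    exacts [le_rfl, Experiment.const_le_expect fun q _ => ih q]

lemma missProb_le_one (n : ℕ) (p : Belief Ω) : missProb Z ρ n p ≤ 1 := by
  induction n generalizing p with
  | zero => simp only [missProb]; split_ifs <;> simp
  | succ n ih =>
    simp only [missProb]; split_ifs
    exacts [zero_le_one, Experiment.expect_le_const fun q _ => ih q]

lemma missProb_succ_le (n : ℕ) (p : Belief Ω) : missProb Z ρ (n + 1) p ≤ missProb Z ρ n p := by
  induction n generalizing p with
  | zero =>
    by_cases hp : p ∈ Z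
    · simp [missProb_of_mem hp]
    · simpa [missProb, hp] using missProb_le_one (Z := Z) (ρ := ρ) 1 p
  | succ n ih =>
    by_cases hp : p ∈ Z
    · simp [missProb_of_mem hp]
    · rw [missProb_succ hp, missProb_succ hp]
      exact Experiment.expect_mono fun q _ => ih q

/-- The limit `f` of the miss probabilities is harmonic off `Z`, and `f + u ≤ 1` off `K`. With the
strictly convex term, the sum has no maximum above `1 + η` on the finite set `K`. At `μ` this leaves
`f μ ≤ η + δ / 2 = δ`. -/
lemma tendsto_missProb {μ : Belief Ω} (hZ : ∀ p e, Act p e → p ∉ Z)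
    (hAct : ∀ p e, Act p e → e.mean = p ∧ e ∉ trivialExperiments Ω)
    (hρ : ∀ ε > 0, ∃ K u, IsCert Act Z K ρ u ∧ 1 - ε ≤ u μ) :
    Tendsto (fun n => missProb Z ρ n μ) atTop (𝓝 0) := by
  let f : Belief Ω → ℝ := fun p => ⨅ n, missProb Z ρ n p
  have hf : ∀ p, Tendsto (fun n => missProb Z ρ n p) atTop (𝓝 (f p)) := fun p =>
    tendsto_atTop_ciInf (antitone_nat_of_succ_le fun n => missProb_succ_le n p)
      ⟨0, by rintro _ ⟨n, rfl⟩; exact missProb_nonneg n p⟩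
  have hf0 : ∀ p, 0 ≤ f p := fun p => ge_of_tendsto' (hf p) fun n => missProb_nonneg n p
  have hf1 : ∀ p, f p ≤ 1 := fun p => le_of_tendsto' (hf p) fun n => missProb_le_one n p
  have hfZ : ∀ p ∈ Z, f p = 0 := fun p hp => by simp [f, missProb_of_mem hp]
  have hfe : ∀ p ∉ Z, f p = (ρ p).expect f := fun p hp => by
    refine tendsto_nhds_unique ((hf p).comp (tendsto_add_atTop_nat 1)) ?_
    refine (Experiment.tendsto_expect fun q _ => hf q).congr fun n => ?_
    exact (missProb_succ hp n).symm
  suffices h : f μ = 0 by simpa [h] using hf μ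
  refine le_antisymm (le_of_forall_pos_le_add fun δ hδ => ?_) (hf0 μ)
  obtain ⟨K, u, c, hu⟩ := hρ (δ / 2) (by positivity)
  set η := δ / 2 with hη
  have hη0 : 0 < η := by positivity
  let G : Belief Ω → ℝ := fun p => f p + u p + η * sqNorm p
  have hs : ∀ p : Belief Ω, η * sqNorm p ≤ η := fun p => by
    simpa using mul_le_mul_of_nonneg_left (sqNorm_le_one p) hη0.le
  have hGoff : ∀ p ∉ K, G p ≤ 1 + η := by
    intro p hp
    simp only [G]
    by_cases hpZ : p ∈ Z
    · rw [hfZ p hpZ]; linarith [c.le_one p, hs p]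
    · rw [c.eq_zero p hp hpZ]; linarith [hf1 p, hs p]
  have hGK : ∀ p ∈ K, G p ≤ 1 + η := by
    by_contra! hcon
    obtain ⟨p₁, hp₁, hlt⟩ := hcon
    obtain ⟨p₀, hp₀, hmax⟩ := Finset.exists_max_image K G ⟨p₁, hp₁⟩
    have hle : (ρ p₀).expect G ≤ G p₀ := Experiment.expect_le_const fun q _ => by
      by_cases hq : q ∈ K
      · exact hmax q hq
      · exact (hGoff q hq).trans (hlt.le.trans (hmax p₁ hp₁))
    have ha := c.act p₀ hp₀
    have h1 := mul_lt_mul_of_pos_left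
      (sqNorm_lt_expect_of_nontrivial (hAct _ _ ha).1 (hAct _ _ ha).2) hη0
    have h2 := hfe p₀ (hZ _ _ ha)
    have h3 := c.le_expect p₀ hp₀
    simp only [G] at hle
    rw [Experiment.expect_add, Experiment.expect_add, Experiment.expect_const_mul] at hle
    linarith
  have hGμ : G μ ≤ 1 + η := by
    by_cases hμ : μ ∈ K
    exacts [hGK μ hμ, hGoff μ hμ]
  have := mul_nonneg hη0.le (sqNorm_nonneg μ)
  simp only [G] at hGμ
  linarith

end Certificate

/-! ### Stationary optimal persuasions -/

section Markov

variable {F : Set (Experiment Ω)} {v : Belief Ω → ℝ} {a b : ℝ} {φ : Rule Ω} {μ : Belief Ω}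

namespace Rule

/-- The beliefs reached with positive probability. -/
def reached (φ : Rule Ω) (μ : Belief Ω) : Set (Belief Ω) :=
  {p | ∃ i, ∃ ξ ∈ φ.histories μ i, ξ.last = p}

/-- The nontrivial experiment `e` is chosen by the rule after some history that ends in `p`. -/
def Chooses (φ : Rule Ω) (μ p : Belief Ω) (e : Experiment Ω) : Prop :=
  (∃ i, ∃ ξ ∈ φ.histories μ i, ξ.last = p ∧ φ i ξ = e) ∧ e ∉ trivialExperiments Ω

lemma mem_reached_of_mem_supp {i : ℕ} {ξ : History Ω i} (hξ : ξ ∈ φ.histories μ i)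
    {q : Belief Ω} (hq : q ∈ (φ i ξ).supp) : q ∈ φ.reached μ :=
  ⟨i + 1, _, step_mem hξ hq, rfl⟩

lemma IsPersuasion.chooses (hφ : φ.IsPersuasion F μ ⊤) {i : ℕ} {ξ : History Ω i}
    (hξ : ξ ∈ φ.histories μ i) (hne : φ i ξ ≠ Experiment.triv ξ.last) :
    φ.Chooses μ ξ.last (φ i ξ) := by
  refine ⟨⟨i, ξ, hξ, rfl, rfl⟩, ?_⟩
  rintro ⟨p, hp⟩
  have := (hφ i (by simp) ξ hξ).2
  rw [← hp, Experiment.mean_triv] at this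
  exact hne (by rw [← hp, this])

/-- If only the trivial experiment were ever chosen at this belief, the process would stay there and
the rule would have terminated. The choice found may belong to another history with the same last
belief. -/
lemma exists_chooses (hφ : φ.IsPersuasion F μ ⊤) {i : ℕ} {ξ : History Ω i}
    (hξ : ξ ∈ φ.histories μ i) (hξt : ¬ φ.TerminatesAfter ⊤ ξ) : ∃ e, φ.Chooses μ ξ.last e := by
  by_contra! hcon
  have hstay : ∀ l, ξ.stay l ∈ φ.histories μ (i + l) := by
    intro l
    induction l with
    | zero => exact hξ
    | succ l ih =>
      have htriv : φ (i + l) (ξ.stay l) = Experiment.triv (ξ.stay l).last := by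
        by_contra hne
        have := hφ.chooses ih hne
        rw [last_stay] at this
        exact hcon _ this
      have := step_mem ih (p := ξ.last) (by rw [htriv, last_stay]; simp)
      rwa [htriv, last_stay] at this
  refine hξt fun l _ => ?_
  by_contra hne
  have := hφ.chooses (hstay l) (by rwa [last_stay])
  rw [last_stay] at this
  exact hcon _ this

open Classical in
/-- The conditional probability that after a history and `n` more steps the rule is still active. -/
def activeProb (φ : Rule Ω) : ℕ → (i : ℕ) → History Ω i → ℝ
  | 0, _, ξ => if φ.TerminatesAfter ⊤ ξ then 0 else 1
  | n + 1, i, ξ => (φ i ξ).expect fun p => activeProb φ n (i + 1) (ξ.step (φ i ξ) p)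

lemma activeProb_nonneg (n i : ℕ) (ξ : History Ω i) : 0 ≤ φ.activeProb n i ξ := by
  induction n generalizing i with
  | zero => simp only [activeProb]; split_ifs <;> simp
  | succ n ih => exact Experiment.const_le_expect fun p _ => ih _ _

lemma histSum_activeProb (n i : ℕ) :
    φ.histSum μ i (φ.activeProb n i) = φ.probActive μ ⊤ (i + n) := by
  induction n generalizing i with
  | zero => rfl
  | succ n ih => rw [← add_assoc, add_right_comm, ← ih (i + 1), histSum_succ]; rfl

/-- A conditional probability is at most the unconditional one divided by the positive probability
of `ξ`. -/
lemma tendsto_activeProb (h : Tendsto (φ.probActive μ ⊤) atTop (𝓝 0)) {i : ℕ} {ξ : History Ω i}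
    (hξ : ξ ∈ φ.histories μ i) : Tendsto (fun n => φ.activeProb n i ξ) atTop (𝓝 0) := by
  have hp := prob_pos i ξ hξ
  have h1 : Tendsto (fun n => φ.probActive μ ⊤ (i + n) / ξ.prob) atTop (𝓝 0) := by
    simpa using (h.comp (tendsto_atTop_mono (fun n => Nat.le_add_left n i) tendsto_id)).div_const
      ξ.prob
  refine squeeze_zero (fun n => activeProb_nonneg n i ξ) (fun n => ?_) h1
  rw [le_div_iff₀ hp, mul_comm, ← histSum_activeProb]
  exact Finset.single_le_sum (f := fun ξ => ξ.prob * φ.activeProb n i ξ)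
    (fun η hη => mul_nonneg (prob_pos i η hη).le (activeProb_nonneg n i η)) hξ

/-- The maximum principle for functions of the belief along a rule that terminates almost surely. -/
lemma maximum_principle (hφ : φ.IsPersuasion F μ ⊤)
    (hlim : Tendsto (φ.probActive μ ⊤) atTop (𝓝 0)) {S : Set (Belief Ω)}
    (hS : ∀ i, ∀ ξ ∈ φ.histories μ i, φ.TerminatesAfter ⊤ ξ → ξ.last ∈ S)
    {G : Belief Ω → ℝ} {C M : ℝ} (hC : ∀ p, G p ≤ C) (hM : ∀ p ∈ S, G p ≤ M)
    (hstep : ∀ p ∉ S, ∀ e, φ.Chooses μ p e → G p ≤ e.expect G) :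
    ∀ p ∈ φ.reached μ, G p ≤ M := by
  set B := max (C - M) 0 with hB
  have hB0 : 0 ≤ B := le_max_right _ _
  have hGB : ∀ p, G p ≤ M + B := fun p => by
    have : C - M ≤ B := le_max_left _ _
    linarith [hC p]
  -- Failure to have entered `S` costs at most `B` on the active mass, and that mass vanishes as `n`
  -- grows.
  have key : ∀ n i, ∀ ξ ∈ φ.histories μ i, G ξ.last ≤ M + B * φ.activeProb n i ξ := by
    intro n
    induction n with
    | zero =>
      intro i ξ hξ
      by_cases h : φ.TerminatesAfter ⊤ ξ
      · simpa [activeProb, h] using hM _ (hS i ξ hξ h)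
      · simpa [activeProb, h] using hGB ξ.last
    | succ n ih =>
      intro i ξ hξ
      by_cases h : ξ.last ∈ S
      · have := mul_nonneg hB0 (activeProb_nonneg (φ := φ) (n + 1) i ξ)
        linarith [hM _ h]
      · have h1 : G ξ.last ≤ (φ i ξ).expect G := by
          by_cases ht : φ i ξ = Experiment.triv ξ.last
          · rw [ht, Experiment.expect_triv]
          · exact hstep _ h _ (hφ.chooses hξ ht)
        refine h1.trans ((Experiment.expect_mono fun q hq => ih (i + 1) _ (step_mem hξ hq)).trans ?_)
        rw [Experiment.expect_add, Experiment.expect_const, Experiment.expect_const_mul]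
        exact le_rfl
  rintro p ⟨i, ξ, hξ, rfl⟩
  have hlim' := ((tendsto_activeProb hlim hξ).const_mul B).const_add M
  rw [mul_zero, add_zero] at hlim'
  exact ge_of_tendsto' hlim' fun n => key n i ξ hξ

end Rule

-- Every choice of `φ` preserves `U` in expectation, so any selection from these choices that
-- reaches `Z` almost surely is optimal.
open Classical in
theorem IsOptimal.exists_isMarkov (hT : trivialExperiments Ω ⊆ F) (ha0 : 0 < a)
    (ha : ∀ p, a ≤ v p) (hv : ∀ p, v p ≤ b) (hφ : IsOptimal F v μ φ) :
    ∃ ψ : Rule Ω, IsOptimal F v μ ψ ∧ IsMarkov F μ ψ := by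
  have hv0 : ∀ p, 0 ≤ v p := fun p => ha0.le.trans (ha p)
  set Z : Set (Belief Ω) := {p | v p = supVal F v p} with hZdef
  set R := φ.reached μ with hR
  set Act : Belief Ω → Experiment Ω → Prop := fun p e => p ∉ Z ∧ φ.Chooses μ p e with hActdef
  have hZ : ∀ p e, Act p e → p ∉ Z := fun p e h => h.1
  have hAct : ∀ p e, Act p e → e ∈ F ∧ e.mean = p ∧ e ∉ trivialExperiments Ω ∧
      e.expect (supVal F v) = supVal F v p ∧ p ∈ R ∧ ∀ q ∈ e.supp, q ∈ R := by
    rintro p e ⟨-, ⟨i, ξ, hξ, rfl, rfl⟩, hne⟩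
    have h1 := hφ.1 i (by simp) ξ hξ
    exact ⟨h1.1, h1.2, hne, hφ.expect_supVal hT hv0 hv hξ, ⟨i, ξ, hξ, rfl⟩,
      fun q hq => Rule.mem_reached_of_mem_supp hξ hq⟩
  have hμR : μ ∈ R := ⟨0, History.start μ, by simp [Rule.histories], rfl⟩
  -- The optimal rule cannot terminate at a reached belief outside `Z`, so it makes a nontrivial
  -- choice there at some time.
  have hdef : ∀ p, ∃ e, p ∈ R \ Z → Act p e := by
    intro p
    by_cases hp : p ∈ R \ Z
    · obtain ⟨⟨i, ξ, hξ, rfl⟩, hpZ⟩ := hp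
      obtain ⟨e, he⟩ := Rule.exists_chooses hφ.1 hξ
        fun ht => hpZ (hφ.eq_supVal_of_terminatesAfter hT hv0 hv hξ ht)
      exact ⟨e, fun _ => ⟨hpZ, he⟩⟩
    · exact ⟨Experiment.triv p, fun h => absurd h hp⟩
  choose ρ₀ hρ₀ using hdef
  have hcert : ∀ (K : Finset (Belief Ω)) (ρ : Belief Ω → Experiment Ω),
      (∀ p ∈ K, Act p (ρ p)) → certSup Act Z K ρ μ = 1 := by
    intro K ρ hK
    refine certSup_eq_one_of_maximum_principle (R := R) hZ hK
      (fun p e h => ⟨(hAct p e h).2.2.2.2.1, (hAct p e h).2.1, (hAct p e h).2.2.1,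
        (hAct p e h).2.2.2.2.2⟩) (fun G C M hC hKM hZM hstep => ?_) hμR
    refine Rule.maximum_principle (S := (K : Set (Belief Ω)) ∪ Z) hφ.1
      (hφ.tendsto_probActive hT ha0 ha hv)
      (fun i ξ hξ ht => Or.inr (hφ.eq_supVal_of_terminatesAfter hT hv0 hv hξ ht)) hC
      (fun p hp => hp.elim (fun h => hKM p h) (hZM p)) fun p hp e he => ?_
    rw [Set.mem_union, not_or] at hp
    exact hstep p hp.1 e ⟨hp.2, he⟩
  obtain ⟨ρ, hρ, hρcert⟩ := exists_strategy_of_certSup hZ hcert (D := R \ Z) hρ₀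
  have hmiss := tendsto_missProb hZ (fun p e h => ⟨(hAct p e h).2.1, (hAct p e h).2.2.1⟩) hρcert
  let ψ : Rule Ω := fun i ξ => if ξ.last ∈ Z then Experiment.triv ξ.last else ρ ξ.last
  have hψR : ∀ i, ∀ ξ ∈ ψ.histories μ i, ξ.last ∈ R := by
    refine Rule.histories_induction (P := fun _ ξ => ξ.last ∈ R) hμR fun i ξ _ ih p hp => ?_
    by_cases hs : ξ.last ∈ Z
    · simp only [ψ, hs, if_true, Experiment.supp_triv, Finset.mem_singleton] at hp
      simpa [History.last, hp] using ih
    · simp only [ψ, hs, if_false] at hp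
      exact (hAct _ _ (hρ _ ⟨ih, hs⟩)).2.2.2.2.2 p hp
  have hψ : ψ.IsPersuasion F μ ⊤ := by
    intro i _ ξ hξ
    by_cases hs : ξ.last ∈ Z
    · simp only [ψ, hs, if_true]
      exact ⟨Experiment.triv_mem hT _, Experiment.mean_triv _⟩
    · simp only [ψ, hs, if_false]
      have := hAct _ _ (hρ _ ⟨hψR i ξ hξ, hs⟩)
      exact ⟨this.1, this.2.1⟩
  have hψmiss : ∀ n i, (ψ.histSum μ i fun ξ => missProb Z ρ n ξ.last) =
      ψ.histSum μ (i + n) fun ξ => if ξ.last ∈ Z then 0 else 1 := by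
    intro n
    induction n with
    | zero => intro i; rfl
    | succ n ih =>
      intro i
      rw [← add_assoc, add_right_comm, ← ih (i + 1), Rule.histSum_succ]
      refine Rule.histSum_congr fun ξ _ => ?_
      by_cases hs : ξ.last ∈ Z
      · simp only [ψ, hs, if_true, Experiment.expect_triv]
        rw [missProb_of_mem hs]
        exact (missProb_of_mem hs n).symm
      · simp only [ψ, hs, if_false, missProb]
        rfl
  refine ⟨ψ, ⟨hψ, le_antisymm ?_ ?_⟩, R \ Z, R ∩ Z, fun p => ρ p, ?_, ?_, ?_, ?_⟩
  · rw [vInf_eq_supVal hT hv0 hv]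
    exact Rule.infValue_le_supVal hT hv0 hv hψ
  · rw [vInf_eq_supVal hT hv0 hv]
    refine Rule.le_infValue hv0 hv (T := fun _ p => p ∈ Z) (fun _ => supVal F v)
      (fun _ p => supVal_le hT hv p) (fun i ξ hξ => ?_) (fun i ξ hs => ⟨?_, hs.ge⟩) ?_
    · by_cases hs : ξ.last ∈ Z
      · simp only [ψ, hs, if_true, Experiment.expect_triv]
        exact le_rfl
      · simp only [ψ, hs, if_false]
        exact (hAct _ _ (hρ _ ⟨hψR i ξ hξ, hs⟩)).2.2.2.1.ge
    · exact Rule.terminatesAfter_of_invariant (T := fun _ p => p ∈ Z)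
        (fun _ _ h => h) (fun i ξ h => by simp [ψ, h]) hs
    · refine hmiss.congr fun n => ?_
      have := hψmiss n 0
      rw [Rule.histSum_zero, zero_add] at this
      exact this
  · exact fun p hp hp' => hp'.2 hp.2
  · by_cases hμ : μ ∈ Z
    exacts [Or.inr ⟨hμR, hμ⟩, Or.inl ⟨hμR, hμ⟩]
  · intro p
    have := hAct _ _ (hρ p p.2)
    refine ⟨⟨this.1, this.2.2.1⟩, this.2.1, fun q hq => ?_⟩
    have hqR := this.2.2.2.2.2 q hq
    by_cases hqZ : q ∈ Z
    exacts [Or.inr ⟨hqR, hqZ⟩, Or.inl ⟨hqR, hqZ⟩]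
  · intro i ξ _
    exact ⟨fun hp => if_neg hp.2, fun hp => if_pos hp.2⟩

end Markov

end SeqPersuasion

end

open SeqPersuasion in
theorem mainTheorem3 {Ω : Type*} [Fintype Ω]
    (F : Set (Experiment Ω)) (hT : trivialExperiments Ω ⊆ F)
    (v : Belief Ω → ℝ) (Vlo Vhi : ℝ) (hVlo : 0 < Vlo)
    (hv : ∀ p, v p ∈ Set.Icc Vlo Vhi) (husc : UpperSemicontinuous v)
    (μ : Belief Ω) :
    (ClosedFeasible F → ((∃ φ : Rule Ω, IsOptimal F v μ φ) ↔ UniformTermination F v μ)) ∧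
    ((∃ φ : Rule Ω, IsOptimal F v μ φ) →
      ∃ φ : Rule Ω, IsOptimal F v μ φ ∧ IsMarkov F μ φ) := by
  have hv0 : ∀ p, 0 ≤ v p := fun p => hVlo.le.trans (hv p).1
  refine ⟨fun hF => ⟨?_, ?_⟩, ?_⟩
  · rintro ⟨φ, hφ⟩
    exact hφ.uniformTermination hT hVlo (fun p => (hv p).1) (fun p => (hv p).2)
  · exact fun h => h.exists_isOptimal hT hF husc hv0 (fun p => (hv p).2)
  · rintro ⟨φ, hφ⟩
    exact hφ.exists_isMarkov hT hVlo (fun p => (hv p).1) (fun p => (hv p).2)
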